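/- Let $M$ be a closed 3-manifold with a finite simplicial triangulation $\mathcal T$, with vertices $1,\dots,N$ and set of tetrahedra $\mathcal T_3$. For $r\in\mathbb R^N_{>0}$ and $\{ijkl\}\in\mathcal T_3$ put $$Q_{ijkl}(r)=\Big(\tfrac1{r_i}+\tfrac1{r_j}+\tfrac1{r_k}+\tfrac1{r_l}\Big)^2-2\Big(\tfrac1{r_i^2}+\tfrac1{r_j^2}+\tfrac1{r_k^2}+\tfrac1{r_l^2}\Big).$$ Let $\mathcal M_{\mathcal T}=\{r\in\mathbb R^N_{>0}: Q_{ijkl}(r)>0 \text{ for all } \{ijkl\}\in\mathcal T_3\}$ be the set of real packings; the elements of $\mathbb R^N_{>0}\setminus\mathcal M_{\mathcal T}$ are the virtual packings. If $Q_{ijkl}(r)>0$, let $\alpha_{ijkl}(r)$ be the solid angle at vertex $i$ of the nondegenerate Euclidean tetrahedron $\{ijkl\}$ with edge lengths $r_a+r_b$ ($a\ne b$ in $\{i,j,k,l\}$). Define the extended solid angle by $\tilde\alpha_{ijkl}=\alpha_{ijkl}$ if $Q_{ijkl}(r)>0$; and, if $Q_{ijkl}(r)\le0$, by $\tilde\alpha_{ijkl}=2\pi$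 when the ball of radius $r_i$ goes through the gap between three mutually tangent balls of radii $r_j,r_k,r_l$, that is, when $$r_i\le\Big(\tfrac1{r_j}+\tfrac1{r_k}+\tfrac1{r_l}+2\sqrt{\tfrac1{r_jr_k}+\tfrac1{r_jr_l}+\tfrac1{r_kr_l}}\Big)^{-1},$$ and by $\tilde\alpha_{ijkl}=0$ otherwise. On $\mathcal M_{\mathcal T}$ put $K_i=4\pi-\sum_{\{ijkl\}\in\mathcal T_3}\alpha_{ijkl}$ and $\lambda=\sum_iK_ir_i/\sum_ir_i$; on $\mathbb R^N_{>0}$ put $\widetilde K_i=4\pi-\sum_{\{ijkl\}\in\mathcal T_3}\tilde\alpha_{ijkl}$ and $\tilde\lambda=\sum_i\widetilde K_ir_i/\sum_ir_i$ (for fixed $i$, the sums of solid angles run over the tetrahedra that contain $i$). Then: 1. For every $\{ijkl\}\in\mathcal T_3$ and $r\in\mathbb R^N_{>0}$: a nondegenerate Euclidean tetrahedron with edge lengths $r_a+r_b$ exists if and only if $Q_{ijkl}(r)>0$, and $\tilde\alpha$ then equals the solid angle of every such tetrahedron; if $Q_{ijkl}(r)\le0$, there is exactly one vertex of $\{ijkl\}$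 whose ball goes through the gap of the other three, so $\tilde\alpha$ is $2\pi$ there and $0$ at the other three vertices. Each $\tilde\alpha_{ijkl}$ is continuous on $\mathbb R^N_{>0}$. 2. For every real or virtual packing $r_0\in\mathbb R^N_{>0}$, the extended flow $$\frac{dr_i}{dt}=(\tilde\lambda-\widetilde K_i)\,r_i\qquad(i=1,\dots,N)$$ has a solution $r:[0,\infty)\to\mathbb R^N_{>0}$ with $r(0)=r_0$. 3. Every solution $r:[0,T)\to\mathbb R^N_{>0}$, $0<T<\infty$, of the extended flow extends to a solution $[0,\infty)\to\mathbb R^N_{>0}$ of the extended flow. 4. Every solution $r:[0,T)\to\mathcal M_{\mathcal T}$, $0<T<\infty$, of the normalized combinatorial Yamabe flow $dr_i/dt=(\lambda-K_i)r_i$ extends to a solution $[0,\infty)\to\mathbb R^N_{>0}$ of the extended flow. -/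

import Mathlib

open Set MeasureTheory

noncomputable section

namespace BallPacking

/-! ### Triangulated 3-manifolds -/

/-- The geometric realization of an abstract simplicial complex with vertex set `Fin N`, in
barycentric coordinates, with the topology induced from `Fin N → ℝ`. -/
def realization {N : ℕ} (K : AbstractSimplicialComplex (Fin N)) : Set (Fin N → ℝ) :=
  {x | (∀ v, 0 ≤ x v) ∧ ∑ v, x v = 1 ∧ (Finset.univ.filter fun v => x v ≠ 0) ∈ K.faces}

/-- A (finite, simplicial) triangulation of the space `M` with vertices numbered by `Fin N`.
Every element of `Fin N` is a vertex: `AbstractSimplicialComplex` contains all singletons. -/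
structure Triangulation (M : Type*) [TopologicalSpace M] (N : ℕ) where
  /-- the simplices, given by their vertex sets -/
  complex : AbstractSimplicialComplex (Fin N)
  /-- the identification of the realization with `M` -/
  homeo : realization complex ≃ₜ M

open Classical in
/-- The set of tetrahedra of a triangulation, each given by its four vertices. -/
def Triangulation.tetrahedra {M : Type*} [TopologicalSpace M] {N : ℕ} (T : Triangulation M N) :
    Finset (Finset (Fin N)) :=
  Finset.univ.filter fun τ => τ ∈ T.complex.faces ∧ τ.card = 4

/-! ### Euclidean tetrahedra and solid angles -/

/-- Euclidean 3-space. -/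
abbrev E3 : Type := EuclideanSpace ℝ (Fin 3)

/-- The points `p j`, `j ∈ τ`, are the vertices of a nondegenerate Euclidean tetrahedron whose edge
lengths are `l_{jk} = r_j + r_k`. -/
def IsEuclideanTetrahedron {N : ℕ} (τ : Finset (Fin N)) (r : Fin N → ℝ) (p : Fin N → E3) : Prop :=
  AffineIndependent ℝ (fun j : τ => p j) ∧
    ∀ j ∈ τ, ∀ k ∈ τ, j ≠ k → dist (p j) (p k) = r j + r k

/-- The solid angle at the vertex `p i` of the tetrahedron with vertices `p j`, `j ∈ τ`: the area of
the set of unit vectors which point from `p i` into the cone spanned by the tetrahedron. -/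
def solidAngle {N : ℕ} (p : Fin N → E3) (τ : Finset (Fin N)) (i : Fin N) : ℝ :=
  ((volume : Measure E3).toSphere).real
    {u | ∃ c : Fin N → ℝ, (∀ j, 0 ≤ c j) ∧ (u : E3) = ∑ j ∈ τ.erase i, c j • (p j - p i)}

/-- `Q_τ(r) = (∑ 1/r_j)² - 2 ∑ 1/r_j²`, sums over the vertices of `τ`. -/
def Q {N : ℕ} (τ : Finset (Fin N)) (r : Fin N → ℝ) : ℝ :=
  (∑ j ∈ τ, 1 / r j) ^ 2 - 2 * ∑ j ∈ τ, 1 / r j ^ 2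

open Classical in
/-- The solid angle `α_{ijkl}` at `i` of the Euclidean tetrahedron with edge lengths `r_j + r_k`.
(The value is `0` if there is no such tetrahedron.) -/
def realAngle {N : ℕ} (τ : Finset (Fin N)) (i : Fin N) (r : Fin N → ℝ) : ℝ :=
  if h : ∃ p, IsEuclideanTetrahedron τ r p then solidAngle h.choose τ i else 0

/-- The ball `S_i` goes through the gap between the three mutually tangent balls `S_j`, `S_k`, `S_l`
(`τ = {i, j, k, l}`): `r_i` is at most the radius
`(1/r_j + 1/r_k + 1/r_l + 2 √(1/(r_j r_k) + 1/(r_j r_l) + 1/(r_k r_l)))⁻¹`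
of the small circle tangent to three mutually tangent circles of radii `r_j`, `r_k`, `r_l`. -/
def ThroughGap {N : ℕ} (τ : Finset (Fin N)) (i : Fin N) (r : Fin N → ℝ) : Prop :=
  r i ≤ (∑ j ∈ τ.erase i, 1 / r j +
    2 * √(∑ s ∈ (τ.erase i).powersetCard 2, 1 / ∏ j ∈ s, r j))⁻¹

open Classical in
/-- The extended solid angle `α̃_{ijkl}` at `i`. -/
def extAngle {N : ℕ} (τ : Finset (Fin N)) (i : Fin N) (r : Fin N → ℝ) : ℝ :=
  if 0 < Q τ r then realAngle τ i r
  else if ThroughGap τ i r then 2 * Real.pi else 0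

/-! ### Packings, curvatures and flows -/

/-- `ℝ^N_{>0}`, the set of all (real or virtual) packings. -/
def positiveOrthant (N : ℕ) : Set (Fin N → ℝ) := {r | ∀ i, 0 < r i}

section

variable {M : Type*} [TopologicalSpace M] {N : ℕ}

/-- The space of real ball packings. -/
def realPackings (T : Triangulation M N) : Set (Fin N → ℝ) :=
  {r | r ∈ positiveOrthant N ∧ ∀ τ ∈ T.tetrahedra, 0 < Q τ r}

/-- The combinatorial scalar curvature `K_i = 4π - ∑ α_{ijkl}`. -/
def curvature (T : Triangulation M N) (r : Fin N → ℝ) (i : Fin N) : ℝ :=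
  4 * Real.pi - ∑ τ ∈ T.tetrahedra with i ∈ τ, realAngle τ i r

/-- The extended curvature `K̃_i = 4π - ∑ α̃_{ijkl}`. -/
def extCurvature (T : Triangulation M N) (r : Fin N → ℝ) (i : Fin N) : ℝ :=
  4 * Real.pi - ∑ τ ∈ T.tetrahedra with i ∈ τ, extAngle τ i r

/-- The average `∑ κ_i r_i / ∑ r_i`: the functional `λ` for `κ = K` and `λ̃` for `κ = K̃`. -/
def average (κ r : Fin N → ℝ) : ℝ := (∑ i, κ i * r i) / ∑ i, r i

/-- On the interval `I`, the curve `r` stays in `D` and solves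
`dr_i/dt = (average of κ(r) - κ_i(r)) r_i`; derivatives at end points of `I` are one-sided. -/
def IsFlowOn (D : Set (Fin N → ℝ)) (κ : (Fin N → ℝ) → Fin N → ℝ) (I : Set ℝ)
    (r : ℝ → Fin N → ℝ) : Prop :=
  ∀ t ∈ I, r t ∈ D ∧ ∀ i,
    HasDerivWithinAt (fun s => r s i) ((average (κ (r t)) (r t) - κ (r t) i) * r t i) I t

/-- `r` solves the normalized combinatorial Yamabe flow `dr_i/dt = (λ - K_i) r_i` on `I`. -/
def IsYamabeFlow (T : Triangulation M N) (I : Set ℝ) (r : ℝ → Fin N → ℝ) : Prop :=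
  IsFlowOn (realPackings T) (curvature T) I r

/-- `r` solves the extended flow `dr_i/dt = (λ̃ - K̃_i) r_i` on `I`. -/
def IsExtendedFlow (T : Triangulation M N) (I : Set ℝ) (r : ℝ → Fin N → ℝ) : Prop :=
  IsFlowOn (positiveOrthant N) (extCurvature T) I r

end

end BallPacking

end

/-! In the coordinates `log (r i)` the extended flow is driven by the field `logField`, with
components λ̃ - K̃_i. If the extended angles are continuous and bounded, this field is continuous
and bounded on all of ℝ^N. Peano's theorem then gives a solution for all positive time through every
point. A solution on a bounded interval is Lipschitz, has a limit at the right end, and continues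
from there by Peano again; uniqueness plays no role. On real packings the two curvatures agree, so a
Yamabe solution is an extended solution.

The heart of the matter is continuity of `extAngle` where `Q` vanishes. Move the edge vectors at a
vertex into the triangular position `frame`; their cone is cut out by three half spaces with normals
`coframe`. The height `frameF` is the square root of a positive multiple of `Q`, and the root of a
negative number is `0`, so `coframe` is defined and continuous for all positive radii. When `Q ≤ 0`,
all three normals lie on the third axis, so the half spaces meet in a half space (angle 2π) or in a
plane (angle 0). The signs of `edgeForm` show that the half space occurs exactly at the ball that
goes through the gap. Hence `extAngle = coneAngle (coframe ..)` everywhere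
(`IsLabelling.extAngle_eq`). Finally `coneAngle` is continuous wherever no normal vanishes, even if
the normals are dependent (`continuousAt_coneAngle`), and no vector of `coframe` ever vanishes
(`coframe_ne_zero`). -/

/-! ### Peano existence and continuation for bounded continuous vector fields. -/

section Peano

open Filter Topology

variable {E : Type*} [NormedAddCommGroup E] [NormedSpace ℝ E]

/-- The points of the explicit Euler scheme with step `h` for `x' = g x`. -/
noncomputable def eulerSeq (g : E → E) (x₀ : E) (h : ℝ) : ℕ → E
  | 0 => x₀
  | k + 1 => eulerSeq g x₀ h k + h • g (eulerSeq g x₀ h k)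

/-- The left side telescopes into the terms `h • (g x_j - v)`. With `v` the value of `g` at the
limit point this yields the derivative; with `v = 0` it yields the Lipschitz bound. -/
theorem norm_eulerSeq_sub_le {g : E → E} {x₀ : E} {h : ℝ} (hh : 0 ≤ h) {m k : ℕ} (hmk : m ≤ k)
    {v : E} {ε : ℝ} (hg : ∀ j, m ≤ j → j < k → ‖g (eulerSeq g x₀ h j) - v‖ ≤ ε) :
    ‖eulerSeq g x₀ h k - eulerSeq g x₀ h m - (((k : ℝ) - m) * h) • v‖ ≤ ((k : ℝ) - m) * h * ε := by
  induction k, hmk using Nat.le_induction with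
  | base => simp
  | succ k hmk ih =>
    have h1 := ih fun j hj hjk => hg j hj (by omega)
    have h2 := hg k hmk (by omega)
    have h3 : eulerSeq g x₀ h (k + 1) - eulerSeq g x₀ h m - ((((k + 1 : ℕ) : ℝ) - m) * h) • v
        = (eulerSeq g x₀ h k - eulerSeq g x₀ h m - (((k : ℝ) - m) * h) • v)
          + h • (g (eulerSeq g x₀ h k) - v) := by
      rw [eulerSeq]; push_cast; module
    rw [h3]
    refine (norm_add_le _ _).trans ?_
    rw [norm_smul, Real.norm_of_nonneg hh]
    have := mul_le_mul_of_nonneg_left h2 hh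
    push_cast
    linarith

theorem norm_eulerSeq_sub_le_of_bound {g : E → E} {L : ℝ} (hL : ∀ x, ‖g x‖ ≤ L) (x₀ : E) {h : ℝ}
    (hh : 0 ≤ h) (m k : ℕ) :
    ‖eulerSeq g x₀ h k - eulerSeq g x₀ h m‖ ≤ |(k : ℝ) - m| * h * L := by
  wlog hmk : m ≤ k generalizing m k
  · rw [norm_sub_rev, abs_sub_comm]
    exact this k m (by omega)
  have := norm_eulerSeq_sub_le (g := g) (x₀ := x₀) hh hmk (v := 0) (ε := L)
    fun j _ _ => by simpa using hL _
  rw [abs_of_nonneg (sub_nonneg.2 (Nat.cast_le.2 hmk))]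
  simpa using this

/-- **Peano's theorem** for a bounded continuous vector field: there is a solution for all positive
time through every point. -/
theorem exists_forall_hasDerivWithinAt_Ici [FiniteDimensional ℝ E] {g : E → E} (hg : Continuous g)
    {L : ℝ} (hL : ∀ x, ‖g x‖ ≤ L) (x₀ : E) :
    ∃ x : ℝ → E, x 0 = x₀ ∧ ∀ t ∈ Ici (0 : ℝ), HasDerivWithinAt x (g (x t)) (Ici 0) t := by
  have hL0 : 0 ≤ L := (norm_nonneg _).trans (hL x₀)
  let h : ℕ → ℝ := fun n => 1 / ((n : ℝ) + 1)
  have hpos : ∀ n, 0 < h n := fun n => by positivity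
  have hlim : Tendsto h atTop (𝓝 0) := tendsto_one_div_add_atTop_nhds_zero_nat
  -- Along an ultrafilter every bounded sequence converges, so pointwise limits exist for all `t` at
  -- once, without Arzelà–Ascoli.
  let F : Filter ℕ := (hyperfilter ℕ : Ultrafilter ℕ)
  have hF : F ≤ atTop := Nat.hyperfilter_le_atTop
  let X : ℕ → ℝ → E := fun n t => eulerSeq g x₀ (h n) ⌊t / h n⌋₊
  have hfl : ∀ n t, 0 ≤ t → (⌊t / h n⌋₊ : ℝ) * h n ≤ t ∧ t < (⌊t / h n⌋₊ : ℝ) * h n + h n := by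
    intro n t ht
    have h1 := Nat.floor_le (div_nonneg ht (hpos n).le)
    have h2 := Nat.lt_floor_add_one (t / h n)
    rw [le_div_iff₀ (hpos n)] at h1
    rw [div_lt_iff₀ (hpos n)] at h2
    exact ⟨h1, by linarith⟩
  have hfllim : ∀ t, 0 ≤ t → Tendsto (fun n => (⌊t / h n⌋₊ : ℝ) * h n) F (𝓝 t) := by
    intro t ht
    refine Tendsto.mono_left ?_ hF
    have h1 : Tendsto (fun n => t - h n) atTop (𝓝 t) := by simpa using hlim.const_sub t
    exact tendsto_of_tendsto_of_tendsto_of_le_of_le h1 tendsto_const_nhds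
      (fun n => by have := (hfl n t ht).2; dsimp only; linarith) fun n => (hfl n t ht).1
  have hbd : ∀ n t, 0 ≤ t → X n t ∈ Metric.closedBall x₀ (t * L) := by
    intro n t ht
    rw [mem_closedBall_iff_norm]
    have := norm_eulerSeq_sub_le_of_bound hL x₀ (hpos n).le 0 ⌊t / h n⌋₊
    simp only [Nat.cast_zero, sub_zero, Nat.abs_cast] at this
    exact this.trans (mul_le_mul_of_nonneg_right (hfl n t ht).1 hL0)
  have hex : ∀ t, ∃ y, 0 ≤ t → Tendsto (fun n => X n t) F (𝓝 y) := by
    intro t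
    by_cases ht : 0 ≤ t
    · have hc : IsCompact (Metric.closedBall x₀ (t * L)) :=
        have := FiniteDimensional.proper_real E
        isCompact_closedBall _ _
      obtain ⟨y, -, hy⟩ := hc.ultrafilter_le_nhds ((hyperfilter ℕ).map fun n => X n t)
        (le_principal_iff.2 (Ultrafilter.mem_map.2 (univ_mem' fun n => hbd n t ht)))
      exact ⟨y, fun _ => hy⟩
    · exact ⟨x₀, fun h => absurd h ht⟩
  choose x hx using hex
  have hx0 : x 0 = x₀ := by
    refine tendsto_nhds_unique (hx 0 le_rfl) ?_
    simp [X, eulerSeq]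
  -- The estimate allows any `u ≤ v` near `t`, so it serves for increments to the right of `t` (`u =
  -- t`) and to the left (`v = t`).
  have key : ∀ t, 0 ≤ t → ∀ ε, 0 < ε → ∃ δ, 0 < δ ∧ ∀ u v, 0 ≤ u → u ≤ v → |u - t| < δ →
      |v - t| < δ → ‖x v - x u - (v - u) • g (x t)‖ ≤ (v - u) * ε := by
    intro t ht ε hε
    obtain ⟨ρ, hρ, hgρ⟩ := Metric.continuous_iff.1 hg (x t) ε hε
    -- An Euler time between `u` and `v` differs from the grid time of `t` by at most `δ + h n`.
    -- With `h n < ρ / (8 * (L + 1))` the scheme moves at most `3ρ/8` in between; the other `ρ/2` is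
    -- spent on `X n t → x t`.
    refine ⟨ρ / (4 * (L + 1)), by positivity, fun u v hu huv hut hvt => ?_⟩
    have hv := hu.trans huv
    have e1 : ∀ᶠ n in F, ‖X n t - x t‖ < ρ / 2 := by
      have := (Metric.tendsto_nhds.1 (hx t ht)) (ρ / 2) (by positivity)
      simpa only [dist_eq_norm] using this
    have e2 : ∀ᶠ n in F, h n < ρ / (8 * (L + 1)) :=
      hF ((hlim.eventually (gt_mem_nhds (by positivity))))
    have lim : Tendsto (fun n => ‖X n v - X n u -
        (((⌊v / h n⌋₊ : ℝ) - ⌊u / h n⌋₊) * h n) • g (x t)‖) F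
        (𝓝 ‖x v - x u - (v - u) • g (x t)‖) := by
      refine (((hx v hv).sub (hx u hu)).sub (Tendsto.smul_const ?_ _)).norm
      simpa only [sub_mul] using (hfllim v hv).sub (hfllim u hu)
    have lim' : Tendsto (fun n => ((⌊v / h n⌋₊ : ℝ) - ⌊u / h n⌋₊) * h n * ε) F
        (𝓝 ((v - u) * ε)) := by
      refine Tendsto.mul_const _ ?_
      simpa only [sub_mul] using (hfllim v hv).sub (hfllim u hu)
    refine le_of_tendsto_of_tendsto lim lim' ?_
    filter_upwards [e1, e2] with n h1 h2
    refine norm_eulerSeq_sub_le (hpos n).le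
      (Nat.floor_le_floor (div_le_div_of_nonneg_right huv (hpos n).le)) fun j hj hjk => ?_
    rw [← dist_eq_norm]
    refine (hgρ _ ?_).le
    have hjL : ((⌊u / h n⌋₊ : ℝ)) * h n ≤ j * h n :=
      mul_le_mul_of_nonneg_right (Nat.cast_le.2 hj) (hpos n).le
    have hjR : (j : ℝ) * h n ≤ (⌊v / h n⌋₊ : ℝ) * h n :=
      mul_le_mul_of_nonneg_right (Nat.cast_le.2 hjk.le) (hpos n).le
    have a1 := hfl n u hu
    have a2 := hfl n v hv
    have a3 := hfl n t ht
    have a4 := norm_eulerSeq_sub_le_of_bound hL x₀ (hpos n).le ⌊t / h n⌋₊ j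
    rw [abs_lt] at hut hvt
    have a5 : |(j : ℝ) - ⌊t / h n⌋₊| * h n ≤ ρ / (4 * (L + 1)) + ρ / (8 * (L + 1)) := by
      rw [← abs_of_pos (hpos n), ← abs_mul, abs_of_pos (hpos n), sub_mul, abs_le]
      constructor <;> linarith
    have a6 := mul_le_mul_of_nonneg_right a5 hL0
    have a7 : (ρ / (4 * (L + 1)) + ρ / (8 * (L + 1))) * L ≤ ρ / 2 := by
      have : (ρ / (4 * (L + 1)) + ρ / (8 * (L + 1))) * L = 3 / 8 * ρ * (L / (L + 1)) := by
        field_simp; ring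
      rw [this]
      have : L / (L + 1) ≤ 1 := (div_le_one (by positivity)).2 (by linarith)
      nlinarith
    rw [dist_eq_norm]
    calc ‖eulerSeq g x₀ (h n) j - x t‖
        = ‖(eulerSeq g x₀ (h n) j - X n t) + (X n t - x t)‖ := by congr 1; abel
      _ ≤ _ := norm_add_le _ _
      _ < ρ := by dsimp only [X]; dsimp only [X] at h1; linarith
  refine ⟨x, hx0, fun t ht => ?_⟩
  rw [hasDerivWithinAt_iff_isLittleO, Asymptotics.isLittleO_iff]
  intro ε hε
  obtain ⟨δ, hδ, H⟩ := key t ht ε hε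
  have hn : ∀ᶠ s in 𝓝[Ici 0] t, |s - t| < δ :=
    mem_nhdsWithin_of_mem_nhds (Metric.ball_mem_nhds t hδ)
  filter_upwards [hn, self_mem_nhdsWithin] with s hs hs0
  rcases le_total t s with hts | hst
  · have := H t s ht hts (by simpa using hδ) hs
    rw [Real.norm_of_nonneg (sub_nonneg.2 hts)]
    linarith
  · have := H s t hs0 hst hs (by simpa using hδ)
    rw [Real.norm_eq_abs, abs_of_nonpos (sub_nonpos.2 hst), ← norm_neg]
    have e : -(x s - x t - (s - t) • g (x t)) = x t - x s - (t - s) • g (x t) := by module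
    rw [e]; linarith

/-- A solution on a bounded interval of an equation with bounded continuous vector field extends to
a solution for all positive time. -/
theorem exists_extend_hasDerivWithinAt_Ici [FiniteDimensional ℝ E] {g : E → E} (hg : Continuous g)
    {L : ℝ} (hL : ∀ x, ‖g x‖ ≤ L) {S : ℝ} (hS : 0 < S) {x : ℝ → E}
    (hx : ∀ t ∈ Ico 0 S, HasDerivWithinAt x (g (x t)) (Ico 0 S) t) :
    ∃ y : ℝ → E, EqOn y x (Ico 0 S) ∧
      ∀ t ∈ Ici (0 : ℝ), HasDerivWithinAt y (g (y t)) (Ici 0) t := by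
  have := FiniteDimensional.complete ℝ E
  have hlip : LipschitzOnWith L.toNNReal x (Ico 0 S) :=
    (convex_Ico 0 S).lipschitzOnWith_of_nnnorm_hasDerivWithin_le hx fun t _ => by
      rw [← NNReal.coe_le_coe, coe_nnnorm]
      exact (hL _).trans (Real.le_coe_toNNReal L)
  obtain ⟨z, hz⟩ : ∃ z, Tendsto x (𝓝[Ico 0 S] S) (𝓝 z) := by
    have hne : (𝓝[Ico 0 S] S).NeBot := by
      rw [← mem_closure_iff_nhdsWithin_neBot, closure_Ico hS.ne]
      exact right_mem_Icc.2 hS.le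
    have hc : Cauchy (map x (𝓝[Ico 0 S] S)) := by
      have hu := hlip.uniformContinuousOn
      have : (𝓝 S ⊓ 𝓟 (Ico 0 S)).NeBot := hne
      exact (cauchy_nhds.mono inf_le_left).map_of_le hu inf_le_right
    exact cauchy_map_iff_exists_tendsto.1 hc
  rw [nhdsWithin_Ico_eq_nhdsLT hS] at hz
  obtain ⟨w, hw0, hw⟩ := exists_forall_hasDerivWithinAt_Ici hg hL z
  let y : ℝ → E := fun t => if t < S then x t else w (t - S)
  have hyx : ∀ t, t < S → y t = x t := fun t ht => if_pos ht
  have hyw : ∀ t, S ≤ t → y t = w (t - S) := fun t ht => if_neg ht.not_gt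
  have hyS : y S = z := by rw [hyw S le_rfl, sub_self, hw0]
  have hleft : ∀ t ∈ Ico 0 S, HasDerivWithinAt y (g (y t)) (Ici 0) t := by
    intro t ht
    rw [hyx t ht.2]
    have h1 := (hx t ht).congr (f₁ := y) (fun s hs => hyx s hs.2) (hyx t ht.2)
    refine h1.mono_of_mem_nhdsWithin ?_
    rw [← Ici_inter_Iio]
    exact inter_mem self_mem_nhdsWithin (mem_nhdsWithin_of_mem_nhds (Iio_mem_nhds ht.2))
  have hright : ∀ t, S ≤ t → HasDerivWithinAt y (g (y t)) (Ici S) t := by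
    intro t ht
    rw [hyw t ht]
    have h1 := (hw (t - S) (sub_nonneg.2 ht)).scomp t
      ((hasDerivAt_id t).sub_const S).hasDerivWithinAt
      (s := Ici S) (fun s (hs : S ≤ s) => sub_nonneg.2 hs)
    rw [one_smul] at h1
    exact h1.congr (fun s hs => hyw s hs) (hyw t ht)
  have hatleft : ∀ t ∈ Ioo 0 S, HasDerivAt y (g (y t)) t := fun t ht =>
    (hleft t ⟨ht.1.le, ht.2⟩).hasDerivAt (Ici_mem_nhds ht.1)
  refine ⟨y, fun t ht => hyx t ht.2, fun t ht => ?_⟩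
  rcases lt_trichotomy t S with htS | rfl | htS
  · exact hleft t ⟨ht, htS⟩
  · have hylim : Tendsto y (𝓝[<] t) (𝓝 (y t)) := by
      rw [hyS]
      exact hz.congr' (eventually_nhdsWithin_of_forall fun s hs => (hyx s hs).symm)
    have hmem : Ioo 0 t ∈ 𝓝[<] t := Ioo_mem_nhdsLT hS
    -- At the seam the left derivative is the limit of the derivatives `g (y s)` from the left; the
    -- right derivative comes from the Peano solution `w`.
    have hd : HasDerivWithinAt y (g (y t)) (Iic t) t := by
      refine hasDerivWithinAt_Iic_of_tendsto_deriv (s := Ioo 0 t)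
        (fun s hs => (hatleft s hs).differentiableAt.differentiableWithinAt)
        (hylim.mono_left (nhdsWithin_mono _ fun s hs => hs.2)) hmem ?_
      refine ((hg.tendsto _).comp hylim).congr' ?_
      filter_upwards [hmem] with s hs using (hatleft s hs).deriv.symm
    have := hd.union (hright t le_rfl)
    rw [Iic_union_Ici] at this
    exact this.mono (subset_univ _)
  · exact ((hright t htS.le).hasDerivAt (Ici_mem_nhds htS)).hasDerivWithinAt

end Peano

namespace BallPacking

open Filter Topology

/-! ### The flow in logarithmic coordinates. -/

section Flow

variable {N : ℕ} {κ : (Fin N → ℝ) → Fin N → ℝ} {C : ℝ}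

theorem sum_pos_of_mem_positiveOrthant {r : Fin N → ℝ} (hr : r ∈ positiveOrthant N) (i : Fin N) :
    0 < ∑ j, r j :=
  Finset.sum_pos (fun j _ => hr j) ⟨i, Finset.mem_univ i⟩

theorem abs_average_le {r : Fin N → ℝ} (hr : r ∈ positiveOrthant N) {k : Fin N → ℝ} (i : Fin N)
    (hb : ∀ i, |k i| ≤ C) : |average k r| ≤ C := by
  have hs := sum_pos_of_mem_positiveOrthant hr i
  rw [average, abs_div, abs_of_pos hs, div_le_iff₀ hs, Finset.mul_sum]
  refine (Finset.abs_sum_le_sum_abs _ _).trans (Finset.sum_le_sum fun j _ => ?_)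
  rw [abs_mul, abs_of_pos (hr j)]
  exact mul_le_mul_of_nonneg_right (hb j) (hr j).le

/-- The vector field of the flow in the coordinates `log r_i`. -/
noncomputable def logField (κ : (Fin N → ℝ) → Fin N → ℝ) (x : Fin N → ℝ) (i : Fin N) : ℝ :=
  average (κ fun j => Real.exp (x j)) (fun j => Real.exp (x j)) - κ (fun j => Real.exp (x j)) i

theorem exp_mem_positiveOrthant (x : Fin N → ℝ) : (fun j => Real.exp (x j)) ∈ positiveOrthant N :=
  fun j => Real.exp_pos (x j)

theorem continuous_logField (hc : ∀ i, ContinuousOn (fun r => κ r i) (positiveOrthant N)) :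
    Continuous (logField κ) := by
  have h1 : ∀ i, Continuous fun x : Fin N → ℝ => κ (fun j => Real.exp (x j)) i := fun i =>
    (hc i).comp_continuous (by fun_prop) exp_mem_positiveOrthant
  refine continuous_pi fun i => ?_
  refine Continuous.sub (Continuous.div ?_ (by fun_prop) fun x =>
    (sum_pos_of_mem_positiveOrthant (exp_mem_positiveOrthant x) i).ne') (h1 i)
  exact continuous_finsetSum _ fun j _ => (h1 j).mul (by fun_prop)

/-- The average has positive weights, so it obeys the same bound as the curvatures. The bound has
`|C|` because for `N = 0` the hypothesis does not force `0 ≤ C`. -/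
theorem norm_logField_le (hb : ∀ r ∈ positiveOrthant N, ∀ i, |κ r i| ≤ C) (x : Fin N → ℝ) :
    ‖logField κ x‖ ≤ 2 * |C| := by
  rw [pi_norm_le_iff_of_nonneg (by positivity)]
  intro i
  have hx := exp_mem_positiveOrthant x
  have h1 := abs_average_le hx i (hb _ hx)
  have h2 := hb _ hx i
  have h3 := le_abs_self C
  refine (abs_sub _ _).trans ?_
  linarith

theorem isFlowOn_exp {I : Set ℝ} {x : ℝ → Fin N → ℝ}
    (hx : ∀ t ∈ I, HasDerivWithinAt x (logField κ (x t)) I t) :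
    IsFlowOn (positiveOrthant N) κ I fun t i => Real.exp (x t i) := fun t ht =>
  ⟨exp_mem_positiveOrthant _, fun i => by
    have := ((hasDerivWithinAt_pi.1 (hx t ht)) i).exp
    rwa [mul_comm] at this⟩

theorem IsFlowOn.hasDerivWithinAt_log {I : Set ℝ} {r : ℝ → Fin N → ℝ}
    (hr : IsFlowOn (positiveOrthant N) κ I r) {t : ℝ} (ht : t ∈ I) :
    HasDerivWithinAt (fun t i => Real.log (r t i)) (logField κ fun i => Real.log (r t i)) I t := by
  refine hasDerivWithinAt_pi.2 fun i => ?_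
  obtain ⟨h1, h2⟩ := hr t ht
  have e : (fun j => Real.exp (Real.log (r t j))) = r t := funext fun j => Real.exp_log (h1 j)
  have h3 := (h2 i).log (h1 i).ne'
  rwa [mul_div_assoc, div_self (h1 i).ne', mul_one, ← e] at h3

theorem exists_isFlowOn_Ici (hc : ∀ i, ContinuousOn (fun r => κ r i) (positiveOrthant N))
    (hb : ∀ r ∈ positiveOrthant N, ∀ i, |κ r i| ≤ C) {r₀ : Fin N → ℝ}
    (hr₀ : r₀ ∈ positiveOrthant N) :
    ∃ r : ℝ → Fin N → ℝ, r 0 = r₀ ∧ IsFlowOn (positiveOrthant N) κ (Ici 0) r := by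
  obtain ⟨x, hx0, hx⟩ := exists_forall_hasDerivWithinAt_Ici (continuous_logField hc)
    (norm_logField_le hb) fun i => Real.log (r₀ i)
  refine ⟨_, ?_, isFlowOn_exp hx⟩
  simp only [hx0]
  exact funext fun j => Real.exp_log (hr₀ j)

theorem IsFlowOn.exists_extend_Ici
    (hc : ∀ i, ContinuousOn (fun r => κ r i) (positiveOrthant N))
    (hb : ∀ r ∈ positiveOrthant N, ∀ i, |κ r i| ≤ C) {S : ℝ} (hS : 0 < S) {r : ℝ → Fin N → ℝ}
    (hr : IsFlowOn (positiveOrthant N) κ (Ico 0 S) r) :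
    ∃ R : ℝ → Fin N → ℝ, EqOn R r (Ico 0 S) ∧ IsFlowOn (positiveOrthant N) κ (Ici 0) R := by
  obtain ⟨y, hyx, hy⟩ := exists_extend_hasDerivWithinAt_Ici (continuous_logField hc)
    (norm_logField_le hb) hS fun t ht => hr.hasDerivWithinAt_log ht
  refine ⟨_, fun t ht => ?_, isFlowOn_exp hy⟩
  simp only [hyx ht]
  exact funext fun j => Real.exp_log ((hr t ht).1 j)

end Flow

/-! ### Solid angles as volumes of intersections of half spaces with the unit ball. -/

section SolidAngle

open Metric in
/-- The measure of the spherical polygon cut out by the half spaces `0 ≤ ⟪w m, u⟫`. -/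
noncomputable def coneAngle (w : Fin 3 → E3) : ℝ :=
  3 * (volume : Measure E3).real {u | u ∈ ball (0 : E3) 1 \ {0} ∧ ∀ m, 0 ≤ inner ℝ (w m) u}

theorem isClosed_setOf_inner_nonneg (w : Fin 3 → E3) :
    IsClosed {u : E3 | ∀ m, 0 ≤ inner ℝ (w m) u} := by
  simp only [ofPred_forall]
  exact isClosed_iInter fun m => isClosed_le continuous_const (by fun_prop)

theorem measurableSet_coneBall (w : Fin 3 → E3) :
    MeasurableSet {u | u ∈ Metric.ball (0 : E3) 1 \ {0} ∧ ∀ m, 0 ≤ inner ℝ (w m) u} :=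
  (measurableSet_ball.diff (measurableSet_singleton _)).inter
    (isClosed_setOf_inner_nonneg w).measurableSet

theorem volume_inner_eq_zero {w : E3} (hw : w ≠ 0) :
    (volume : Measure E3) {u | inner ℝ w u = 0} = 0 := by
  have h := Measure.addHaar_submodule (volume : Measure E3) (LinearMap.ker (innerₛₗ ℝ w)) fun h => by
    have : w ∈ LinearMap.ker (innerₛₗ ℝ w) := h ▸ Submodule.mem_top
    simp [LinearMap.mem_ker] at this
    exact hw this
  exact h

/-- Off the three planes orthogonal to the `w m` every condition `0 ≤ ⟪w m, u⟫` is strict or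
strictly violated, hence stable under small changes of `w`. The planes are null sets because `w m ≠
0`, so the indicators converge almost everywhere inside the unit ball. Independence of the normals
is not needed, which is what permits degenerate tetrahedra. -/
theorem continuousAt_coneAngle {w : Fin 3 → E3} (hw : ∀ m, w m ≠ 0) :
    ContinuousAt coneAngle w := by
  refine ContinuousAt.mul continuousAt_const ?_
  refine (ENNReal.tendsto_toReal ?_).comp (tendsto_measure_of_ae_tendsto_indicator (𝓝 w)
    (measurableSet_coneBall w) measurableSet_coneBall measurableSet_ball
    (measure_ball_lt_top (x := (0 : E3)) (r := 1)).ne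
    (Eventually.of_forall fun w' u hu => hu.1.1) ?_)
  · exact ((measure_mono fun u hu => hu.1.1).trans_lt
      (measure_ball_lt_top (x := (0 : E3)) (r := 1))).ne
  have h : ∀ m, ∀ᵐ u : E3, inner ℝ (w m) u ≠ 0 := fun m => by
    rw [ae_iff]
    simpa using volume_inner_eq_zero (hw m)
  filter_upwards [ae_all_iff.2 h] with u hu
  have hev : ∀ m, ∀ᶠ w' in 𝓝 w, (0 ≤ inner ℝ (w' m) u ↔ 0 ≤ inner ℝ (w m) u) := by
    intro m
    have ht : Tendsto (fun w' : Fin 3 → E3 => inner ℝ (w' m) u) (𝓝 w) (𝓝 (inner ℝ (w m) u)) :=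
      Continuous.tendsto (by fun_prop) w
    rcases (hu m).lt_or_gt with h | h
    · filter_upwards [ht.eventually (gt_mem_nhds h)] with w' hw'
      exact iff_of_false hw'.not_ge h.not_ge
    · filter_upwards [ht.eventually (lt_mem_nhds h)] with w' hw'
      exact iff_of_true hw'.le h.le
  filter_upwards [eventually_all.2 hev] with w' hw'
  simp only [hw']

theorem coneAngle_nonneg (w : Fin 3 → E3) : 0 ≤ coneAngle w :=
  mul_nonneg (by norm_num) measureReal_nonneg

theorem volume_real_ball : (volume : Measure E3).real (Metric.ball 0 1) = Real.pi * 4 / 3 := by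
  rw [measureReal_def, EuclideanSpace.volume_ball_fin_three]
  have : 0 ≤ Real.pi * 4 / 3 := by positivity
  simp [this]

theorem coneAngle_le (w : Fin 3 → E3) : coneAngle w ≤ 4 * Real.pi := by
  have h : (volume : Measure E3).real
      {u | u ∈ Metric.ball (0 : E3) 1 \ {0} ∧ ∀ m, 0 ≤ inner ℝ (w m) u} ≤ Real.pi * 4 / 3 := by
    rw [← volume_real_ball]
    exact measureReal_mono (fun u hu => hu.1.1) (measure_ball_lt_top).ne
  rw [coneAngle]; linarith

theorem coneAngle_eq_zero {w : Fin 3 → E3} {v : E3} (hv : v ≠ 0)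
    (h : ∀ u, (∀ m, 0 ≤ inner ℝ (w m) u) → inner ℝ v u = 0) : coneAngle w = 0 := by
  have : (volume : Measure E3)
      {u | u ∈ Metric.ball (0 : E3) 1 \ {0} ∧ ∀ m, 0 ≤ inner ℝ (w m) u} = 0 :=
    measure_mono_null (fun u hu => h u hu.2) (volume_inner_eq_zero hv)
  rw [coneAngle, measureReal_def, this]; simp

theorem coneAngle_eq_two_pi {w : Fin 3 → E3} {v : E3} (hv : v ≠ 0)
    (h : ∀ u, (∀ m, 0 ≤ inner ℝ (w m) u) ↔ 0 ≤ inner ℝ v u) : coneAngle w = 2 * Real.pi := by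
  let A : Set E3 := {u | u ∈ Metric.ball (0 : E3) 1 ∧ 0 ≤ inner ℝ v u}
  let A' : Set E3 := {u | u ∈ Metric.ball (0 : E3) 1 ∧ inner ℝ v u < 0}
  have hfin : (volume : Measure E3) (Metric.ball 0 1) ≠ ⊤ := measure_ball_lt_top.ne
  have h1 : (volume : Measure E3)
      {u | u ∈ Metric.ball (0 : E3) 1 \ {0} ∧ ∀ m, 0 ≤ inner ℝ (w m) u} = volume A := by
    have : {u | u ∈ Metric.ball (0 : E3) 1 \ {0} ∧ ∀ m, 0 ≤ inner ℝ (w m) u} = A \ {0} := by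
      ext u; simp only [h, A, Set.mem_sdiff, mem_ofPred_eq]; tauto
    rw [this]
    exact measure_sdiff_null (measure_singleton 0)
  have hA' : MeasurableSet A' := (Metric.isOpen_ball.inter
    (isOpen_lt (by fun_prop : Continuous fun u : E3 => inner ℝ v u) continuous_const)).measurableSet
  -- The reflection `u ↦ -u` exchanges the two half balls up to the null plane `⟪v, u⟫ = 0`.
  have h2 : (volume : Measure E3) A = volume A' := by
    have e : volume A' = (volume : Measure E3) (Neg.neg ⁻¹' A') :=
      (Measure.measurePreserving_neg (volume : Measure E3)).measure_preimage
        hA'.nullMeasurableSet |>.symm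
    rw [e]
    refine measure_congr ?_
    have hne : ∀ᵐ u : E3, inner ℝ v u ≠ 0 := by
      rw [ae_iff]; simpa using volume_inner_eq_zero hv
    filter_upwards [hne] with u hu
    have : u ∈ A ↔ u ∈ Neg.neg ⁻¹' A' := by
      simp only [A, A', mem_ofPred_eq, mem_preimage, mem_ball_zero_iff, norm_neg, inner_neg_right,
        neg_lt_zero]
      exact and_congr_right fun _ => ⟨fun h => lt_of_le_of_ne h hu.symm, le_of_lt⟩
    exact propext this
  have h3 : (volume : Measure E3).real A + (volume : Measure E3).real A' = Real.pi * 4 / 3 := by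
    rw [← volume_real_ball, ← measureReal_union ?_ hA'
      (measure_ne_top_of_subset (fun u hu => hu.1) hfin)
      (measure_ne_top_of_subset (fun u hu => hu.1) hfin)]
    · congr 1
      ext u
      simp only [A, A', mem_union, mem_ofPred_eq]
      have := le_or_gt 0 (inner ℝ v u)
      tauto
    · exact disjoint_left.2 fun u hu hu' => hu.2.not_gt hu'.2
  rw [coneAngle, measureReal_def, h1, ← measureReal_def]
  have h4 : (volume : Measure E3).real A = (volume : Measure E3).real A' := by
    rw [measureReal_def, h2, measureReal_def]
  linarith

open Pointwise in
theorem solidAngle_eq_coneAngle {N : ℕ} {p : Fin N → E3} {τ : Finset (Fin N)} {i : Fin N}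
    (Φ : E3 ≃ₗᵢ[ℝ] E3) {w : Fin 3 → E3}
    (h : ∀ u : E3, (∃ c : Fin N → ℝ, (∀ j, 0 ≤ c j) ∧ u = ∑ j ∈ τ.erase i, c j • (p j - p i)) ↔
      ∀ m, 0 ≤ inner ℝ (w m) (Φ u)) :
    solidAngle p τ i = coneAngle w := by
  have e : ({u | ∃ c : Fin N → ℝ, (∀ j, 0 ≤ c j) ∧
      (u : E3) = ∑ j ∈ τ.erase i, c j • (p j - p i)} : Set (Metric.sphere (0 : E3) 1)) =
      ({u | ∀ m, 0 ≤ inner ℝ (w m) (Φ u)} : Set (Metric.sphere (0 : E3) 1)) := by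
    ext u; exact h (u : E3)
  have hm : MeasurableSet {u : Metric.sphere (0 : E3) 1 | ∀ m, 0 ≤ inner ℝ (w m) (Φ u)} :=
    ((isClosed_setOf_inner_nonneg w).preimage
      (Φ.continuous.comp continuous_subtype_val)).measurableSet
  have hs : Ioo (0 : ℝ) 1 • (Subtype.val ''
      ({u | ∀ m, 0 ≤ inner ℝ (w m) (Φ u)} : Set (Metric.sphere (0 : E3) 1)))
      = Φ ⁻¹' {u | u ∈ Metric.ball (0 : E3) 1 \ {0} ∧ ∀ m, 0 ≤ inner ℝ (w m) u} := by
    ext u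
    simp only [Set.mem_smul, mem_image, mem_ofPred_eq, mem_preimage, Set.mem_sdiff, mem_ball_zero_iff,
      mem_singleton_iff, Φ.norm_map, map_eq_zero_iff Φ Φ.injective]
    constructor
    · rintro ⟨a, ha, -, ⟨v, hv, rfl⟩, rfl⟩
      have hv1 : ‖(v : E3)‖ = 1 := norm_eq_of_mem_sphere v
      refine ⟨⟨?_, ?_⟩, fun m => ?_⟩
      · rw [norm_smul, hv1, mul_one, Real.norm_of_nonneg ha.1.le]; exact ha.2
      · exact smul_ne_zero ha.1.ne' (norm_ne_zero_iff.1 (by rw [hv1]; norm_num))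
      · rw [map_smul, inner_smul_right]; exact mul_nonneg ha.1.le (hv m)
    · rintro ⟨⟨h1, h2⟩, h3⟩
      have hpos : 0 < ‖u‖ := norm_pos_iff.2 h2
      refine ⟨‖u‖, ⟨hpos, h1⟩, ‖u‖⁻¹ • u, ⟨⟨‖u‖⁻¹ • u, ?_⟩, fun m => ?_, rfl⟩, ?_⟩
      · rw [mem_sphere_zero_iff_norm, norm_smul, norm_inv, norm_norm, inv_mul_cancel₀ hpos.ne']
      · rw [map_smul, inner_smul_right]; exact mul_nonneg (inv_nonneg.2 hpos.le) (h3 m)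
      · rw [smul_smul, mul_inv_cancel₀ hpos.ne', one_smul]
  -- `toSphere` of a set is the dimension, 3, times the volume of the cone over it in the punctured
  -- unit ball; this is the factor in `coneAngle`.
  rw [solidAngle, e, measureReal_def, Measure.toSphere_apply' _ hm, hs,
    Φ.measurePreserving.measure_preimage (measurableSet_coneBall w).nullMeasurableSet,
    coneAngle, measureReal_def]
  simp

/-- Both families are bases, and the linear map matching them preserves the inner product because it
does so on basis vectors. -/
theorem exists_linearIsometryEquiv {v v' : Fin 3 → E3} (hv : LinearIndependent ℝ v)
    (hv' : LinearIndependent ℝ v')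
    (h : ∀ m n, inner ℝ (v m) (v n) = inner ℝ (v' m) (v' n)) :
    ∃ Φ : E3 ≃ₗᵢ[ℝ] E3, ∀ m, Φ (v m) = v' m := by
  have hd : Fintype.card (Fin 3) = Module.finrank ℝ E3 := by simp
  let b := basisOfLinearIndependentOfCardEqFinrank hv hd
  let b' := basisOfLinearIndependentOfCardEqFinrank hv' hd
  have hb : ∀ m, b m = v m := fun m => by simp [b]
  have hb' : ∀ m, b' m = v' m := fun m => by simp [b']
  let f : E3 ≃ₗ[ℝ] E3 := b.equiv b' (Equiv.refl _)
  have hf : ∀ m, f (b m) = b' m := fun m => by simp [f]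
  have hB : (innerₗ E3).compl₁₂ f.toLinearMap f.toLinearMap = innerₗ E3 := by
    refine LinearMap.ext_basis b b fun m n => ?_
    have := hf m
    have := hf n
    simp_all
  refine ⟨f.isometryOfInner fun x y => ?_, fun m => ?_⟩
  · simpa using LinearMap.congr_fun₂ hB x y
  · rw [← hb, ← hb']; exact hf m

end SolidAngle

/-! ### The triangular frame of four tangent balls, its normals, and their degeneration. -/

section Frame

/-- `Q` as a function of the four radii. -/
noncomputable def radiiQ (s x y z : ℝ) : ℝ :=
  (1 / s + 1 / x + 1 / y + 1 / z) ^ 2 - 2 * (1 / s ^ 2 + 1 / x ^ 2 + 1 / y ^ 2 + 1 / z ^ 2)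

/-- The scalar product of the edge vectors from the centre of the ball of radius `s` to the centres
of the balls of radii `x` and `y`, all three balls being tangent to each other. -/
def gramEntry (s x y : ℝ) : ℝ := s ^ 2 + s * x + s * y - x * y

/-- First coordinate of the second edge vector of `frame`. -/
noncomputable def frameB (s x y : ℝ) : ℝ := gramEntry s x y / (s + x)

/-- Second coordinate of the second edge vector of `frame`. -/
noncomputable def frameC (s x y : ℝ) : ℝ := 2 * √(s * x * y * (s + x + y)) / (s + x)

/-- Second coordinate of the third edge vector of `frame`. -/
noncomputable def frameE (s x y z : ℝ) : ℝ :=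
  (gramEntry s y z - frameB s x y * frameB s x z) / frameC s x y

/-- Third coordinate of the third edge vector of `frame`. It is `0` for virtual packings. -/
noncomputable def frameF (s x y z : ℝ) : ℝ :=
  √(s * x * y * z ^ 2 * radiiQ s x y z / (s + x + y))

/-- The edge vectors, at the centre of the ball of radius `s`, of the tetrahedron spanned by the
centres of four mutually tangent balls, in a position such that their matrix is triangular. -/
noncomputable def frame (s x y z : ℝ) : Fin 3 → E3 :=
  ![!₂[s + x, 0, 0], !₂[frameB s x y, frameC s x y, 0],
    !₂[frameB s x z, frameE s x y z, frameF s x y z]]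

/-- Normal vectors to the sides of the cone spanned by `frame s x y z`. -/
noncomputable def coframe (s x y z : ℝ) : Fin 3 → E3 :=
  ![!₂[frameF s x y z * frameC s x y, -(frameF s x y z * frameB s x y),
      frameE s x y z * frameB s x y - frameB s x z * frameC s x y],
    !₂[0, frameF s x y z, -frameE s x y z], !₂[0, 0, 1]]

variable {s x y z : ℝ}

theorem inner_mk_three (a b c a' b' c' : ℝ) :
    inner ℝ (!₂[a, b, c] : E3) !₂[a', b', c'] = a * a' + b * b' + c * c' := by
  simp [PiLp.inner_apply, Fin.sum_univ_three, mul_comm]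

theorem inner_mk_three_left (a b c : ℝ) (u : E3) :
    inner ℝ (!₂[a, b, c] : E3) u = a * u 0 + b * u 1 + c * u 2 := by
  simp [PiLp.inner_apply, Fin.sum_univ_three, mul_comm]

theorem frameC_pos (hs : 0 < s) (hx : 0 < x) (hy : 0 < y) : 0 < frameC s x y := by
  unfold frameC; positivity

theorem frameC_sq (hs : 0 < s) (hx : 0 < x) (hy : 0 < y) :
    frameC s x y ^ 2 = 4 * (s * x * y * (s + x + y)) / (s + x) ^ 2 := by
  rw [frameC, div_pow, mul_pow, Real.sq_sqrt (by positivity)]; norm_num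

/-- Heron's formula: `frameC` is the altitude on the side `s + x` of the triangle with sides `s +
x`, `s + y`, `x + y`. -/
theorem frameB_sq_add_frameC_sq (hs : 0 < s) (hx : 0 < x) (hy : 0 < y) :
    frameB s x y ^ 2 + frameC s x y ^ 2 = (s + y) ^ 2 := by
  rw [frameC_sq hs hx hy, frameB, gramEntry]; field_simp; ring

theorem frameF_sq (hs : 0 < s) (hx : 0 < x) (hy : 0 < y) (hQ : 0 ≤ radiiQ s x y z) :
    frameF s x y z ^ 2 = s * x * y * z ^ 2 * radiiQ s x y z / (s + x + y) :=
  Real.sq_sqrt (by positivity)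

theorem frameF_pos (hs : 0 < s) (hx : 0 < x) (hy : 0 < y) (hz : 0 < z)
    (hQ : 0 < radiiQ s x y z) : 0 < frameF s x y z :=
  Real.sqrt_pos.2 (by positivity)

theorem frameF_eq_zero (hs : 0 < s) (hx : 0 < x) (hy : 0 < y)
    (hQ : radiiQ s x y z ≤ 0) : frameF s x y z = 0 := by
  refine Real.sqrt_eq_zero_of_nonpos (div_nonpos_of_nonpos_of_nonneg ?_ (by positivity))
  exact mul_nonpos_of_nonneg_of_nonpos (by positivity) hQ

theorem norm_sq_frame_two (hs : 0 < s) (hx : 0 < x) (hy : 0 < y) (hz : 0 < z)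
    (hQ : 0 ≤ radiiQ s x y z) :
    frameB s x z ^ 2 + frameE s x y z ^ 2 + frameF s x y z ^ 2 = (s + z) ^ 2 := by
  rw [frameF_sq hs hx hy hQ, frameE, div_pow, frameC_sq hs hx hy, frameB, frameB, gramEntry,
    gramEntry, gramEntry, radiiQ]
  field_simp
  ring

/-- The sign of the scalar product of two sides' normals, up to a positive factor. -/
noncomputable def edgeForm (s x y z : ℝ) : ℝ :=
  (1 / s + 1 / x) * (1 / y + 1 / z) - 1 / s ^ 2 - 1 / x ^ 2

/-- Once `frameF` vanishes, only the third coordinates of the normals remain. This lemma and the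
next one read off the signs of the two nontrivial ones from the curvatures `1 / r`. -/
theorem frameE_eq (hs : 0 < s) (hx : 0 < x) (hy : 0 < y) (hz : 0 < z) :
    frameE s x y z =
      2 * s ^ 2 * x ^ 2 * y * z / ((s + x) ^ 2 * frameC s x y) * edgeForm s x y z := by
  have hc := frameC_pos hs hx hy
  rw [frameE, frameB, frameB, gramEntry, gramEntry, gramEntry, edgeForm]
  field_simp
  ring

theorem frameE_mul_frameB_sub (hs : 0 < s) (hx : 0 < x) (hy : 0 < y) (hz : 0 < z) :
    frameE s x y z * frameB s x y - frameB s x z * frameC s x y =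
      -(2 * s ^ 2 * y ^ 2 * x * z / ((s + x) * frameC s x y) * edgeForm s y x z) := by
  have hc := frameC_pos hs hx hy
  have h2 := frameC_sq hs hx hy
  have : frameE s x y z * frameB s x y - frameB s x z * frameC s x y =
      ((gramEntry s y z - frameB s x y * frameB s x z) * frameB s x y
        - frameB s x z * frameC s x y ^ 2) / frameC s x y := by
    rw [frameE]; field_simp
  rw [this, h2, frameB, frameB, gramEntry, gramEntry, gramEntry, edgeForm]
  field_simp
  ring

/-- The Gram matrix of the edge vectors at the centre of the ball of radius `s`. -/
def gramMatrix (s x y z : ℝ) : Matrix (Fin 3) (Fin 3) ℝ :=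
  !![(s + x) ^ 2, gramEntry s x y, gramEntry s x z;
     gramEntry s x y, (s + y) ^ 2, gramEntry s y z;
     gramEntry s x z, gramEntry s y z, (s + z) ^ 2]

theorem inner_frame (hs : 0 < s) (hx : 0 < x) (hy : 0 < y) (hz : 0 < z)
    (hQ : 0 ≤ radiiQ s x y z) (m n : Fin 3) :
    inner ℝ (frame s x y z m) (frame s x y z n) =
      gramMatrix s x y z m n := by
  have hc := frameC_pos hs hx hy
  have h0 : s + x ≠ 0 := by positivity
  have h1 := frameB_sq_add_frameC_sq hs hx hy
  have h2 := norm_sq_frame_two hs hx hy hz hQ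
  have h3 : frameB s x y * frameB s x z + frameC s x y * frameE s x y z = gramEntry s y z := by
    rw [frameE]; field_simp; ring
  have h4 : (s + x) * frameB s x y = gramEntry s x y := by rw [frameB]; field_simp
  have h5 : (s + x) * frameB s x z = gramEntry s x z := by rw [frameB]; field_simp
  fin_cases m <;> fin_cases n <;>
    simp [frame, gramMatrix, inner_mk_three, EuclideanSpace.norm_sq_eq, Fin.sum_univ_three] <;>
    linarith

theorem linearIndependent_frame (hs : 0 < s) (hx : 0 < x) (hy : 0 < y) (hz : 0 < z)
    (hQ : 0 < radiiQ s x y z) : LinearIndependent ℝ (frame s x y z) := by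
  rw [Fintype.linearIndependent_iff]
  intro g hg
  have hc := (frameC_pos hs hx hy).ne'
  have hf := (frameF_pos hs hx hy hz hQ).ne'
  have h0 : s + x ≠ 0 := by positivity
  have e2 : g 2 = 0 := by simpa [frame, Fin.sum_univ_three, hf] using congr($hg 2)
  have e1 : g 1 = 0 := by simpa [frame, Fin.sum_univ_three, hc, e2] using congr($hg 1)
  have e0 : g 0 = 0 := by simpa [frame, Fin.sum_univ_three, h0, e1, e2] using congr($hg 0)
  intro m; fin_cases m <;> assumption

theorem forall_inner_coframe_nonneg_iff (u : E3) :
    (∀ m, 0 ≤ inner ℝ (coframe s x y z m) u) ↔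
      0 ≤ frameF s x y z * frameC s x y * u 0 - frameF s x y z * frameB s x y * u 1
        + (frameE s x y z * frameB s x y - frameB s x z * frameC s x y) * u 2 ∧
      0 ≤ frameF s x y z * u 1 - frameE s x y z * u 2 ∧ 0 ≤ u 2 := by
  rw [Fin.forall_fin_succ, Fin.forall_fin_succ, Fin.forall_fin_one]
  simp [coframe, inner_mk_three_left, ← sub_eq_add_neg]

theorem exists_eq_frame_iff (hs : 0 < s) (hx : 0 < x) (hy : 0 < y) (hz : 0 < z)
    (hQ : 0 < radiiQ s x y z) (u : E3) :
    (∃ a b c : ℝ, 0 ≤ a ∧ 0 ≤ b ∧ 0 ≤ c ∧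
      u = a • frame s x y z 0 + b • frame s x y z 1 + c • frame s x y z 2) ↔
      ∀ m, 0 ≤ inner ℝ (coframe s x y z m) u := by
  simp only [forall_inner_coframe_nonneg_iff, frame]
  have hC := frameC_pos hs hx hy
  have hF := frameF_pos hs hx hy hz hQ
  have hA : 0 < s + x := by positivity
  generalize frameF s x y z = F at *
  generalize frameC s x y = C at *
  constructor
  · rintro ⟨a, b, c, ha, hb, hc, rfl⟩
    have h1 : 0 ≤ F * C * (a * (s + x)) := by positivity
    have h2 : 0 ≤ F * (b * C) := by positivity
    have h3 : 0 ≤ c * F := by positivity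
    refine ⟨?_, ?_, ?_⟩
    · refine h1.trans_eq ?_
      simp
      ring
    · refine h2.trans_eq ?_
      simp
      ring
    · simpa using h3
  · rintro ⟨h1, h2, h3⟩
    -- Each normal is orthogonal to the other two edge vectors; the denominators are its products
    -- with its own edge vector.
    refine ⟨_, _, _, div_nonneg h1 (by positivity : 0 ≤ F * C * (s + x)),
      div_nonneg h2 (by positivity : 0 ≤ F * C), div_nonneg h3 hF.le, ?_⟩
    ext n
    fin_cases n
    · simp
      field_simp
      ring
    · simp
      field_simp
      ring
    · simp
      field_simp

/-! ### The gap condition and the sign of `Q`, in terms of the curvatures `1 / r`. -/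

/-- The ball of radius `s` goes through the gap between the other three balls. -/
def IsGap (s x y z : ℝ) : Prop :=
  s ≤ (1 / x + 1 / y + 1 / z + 2 * √(1 / (x * y) + 1 / (x * z) + 1 / (y * z)))⁻¹

/-- As a quadratic in `1 / s`, `Q` has the Descartes roots `1/x + 1/y + 1/z ± 2√(..)`. The gap
condition says that `1 / s` is at least the larger root, so for `Q ≤ 0` it suffices to compare `1 /
s` with the midpoint of the roots. -/
theorem radiiQ_eq (s x y z : ℝ) : radiiQ s x y z =
    4 * (1 / x * (1 / y) + 1 / x * (1 / z) + 1 / y * (1 / z))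
      - (1 / s - (1 / x + 1 / y + 1 / z)) ^ 2 := by
  rw [radiiQ]; ring

theorem IsGap.lt (hs : 0 < s) (hx : 0 < x) (hy : 0 < y) (hz : 0 < z) (h : IsGap s x y z) :
    1 / x + 1 / y + 1 / z < 1 / s := by
  rw [IsGap, le_inv_comm₀ hs (by positivity), ← one_div] at h
  have : 0 < √(1 / (x * y) + 1 / (x * z) + 1 / (y * z)) := by positivity
  linarith

theorem isGap_of_lt (hs : 0 < s) (hx : 0 < x) (hy : 0 < y) (hz : 0 < z)
    (hQ : radiiQ s x y z ≤ 0) (h : 1 / x + 1 / y + 1 / z < 1 / s) : IsGap s x y z := by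
  rw [IsGap, le_inv_comm₀ hs (by positivity), ← one_div]
  have h1 : 1 / (x * y) + 1 / (x * z) + 1 / (y * z) ≤
      ((1 / s - (1 / x + 1 / y + 1 / z)) / 2) ^ 2 := by
    rw [radiiQ_eq] at hQ
    rw [← one_div_mul_one_div, ← one_div_mul_one_div, ← one_div_mul_one_div]
    linarith
  have h2 := Real.sqrt_le_sqrt h1
  rw [Real.sqrt_sq (by linarith)] at h2
  linarith

theorem radiiQ_swap₁₂ (s x y z : ℝ) : radiiQ s x y z = radiiQ x s y z := by
  unfold radiiQ; ring

theorem radiiQ_swap₁₃ (s x y z : ℝ) : radiiQ s x y z = radiiQ y x s z := by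
  unfold radiiQ; ring

theorem radiiQ_swap₁₄ (s x y z : ℝ) : radiiQ s x y z = radiiQ z x y s := by
  unfold radiiQ; ring

theorem add_lt_of_forall_le {a b c d : ℝ} (hb : 0 < b) (hc : 0 < c) (hd : 0 < d)
    (hab : b ≤ a) (hac : c ≤ a) (had : d ≤ a)
    (h : 4 * (b * c + b * d + c * d) - (a - (b + c + d)) ^ 2 ≤ 0) : b + c + d < a := by
  by_contra! hle
  -- Otherwise `b + c + d - a` is nonnegative and, `a` being the largest, at most the sum `e` of the
  -- two smallest of `b, c, d`. But `e ^ 2 < 4 * (b * c + b * d + c * d)`, contrary to `h`.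
  have key : ∀ e : ℝ, 0 ≤ e → b + c + d - a ≤ e → e ^ 2 < 4 * (b * c + b * d + c * d) → False := by
    intro e he h1 h2
    nlinarith [pow_le_pow_left₀ (by linarith : 0 ≤ b + c + d - a) h1 2]
  rcases le_total b c with h1 | h1
  · rcases le_total c d with h2 | h2
    · exact key (b + c) (by positivity) (by linarith) (by nlinarith [mul_pos hb hc])
    · exact key (b + d) (by positivity) (by linarith) (by nlinarith [mul_pos hb hd, mul_pos hb hc])
  · rcases le_total b d with h2 | h2
    · exact key (b + c) (by positivity) (by linarith) (by nlinarith [mul_pos hb hc])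
    · exact key (c + d) (by positivity) (by linarith) (by nlinarith [mul_pos hc hd, mul_pos hb hc])

/-- The ball with the largest curvature is the one that passes: `Q` is symmetric, so
`add_lt_of_forall_le` applies to it. -/
theorem exists_add_lt_of_radiiQ_nonpos (hs : 0 < s) (hx : 0 < x) (hy : 0 < y) (hz : 0 < z)
    (hQ : radiiQ s x y z ≤ 0) :
    1 / x + 1 / y + 1 / z < 1 / s ∨ 1 / s + 1 / y + 1 / z < 1 / x ∨
      1 / x + 1 / s + 1 / z < 1 / y ∨ 1 / x + 1 / y + 1 / s < 1 / z := by
  have q1 := hQ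
  have q2 := hQ
  have q3 := hQ
  have q4 := hQ
  rw [radiiQ_eq] at q1
  rw [radiiQ_swap₁₂, radiiQ_eq] at q2
  rw [radiiQ_swap₁₃, radiiQ_eq] at q3
  rw [radiiQ_swap₁₄, radiiQ_eq] at q4
  have ps := one_div_pos.2 hs
  have px := one_div_pos.2 hx
  have py := one_div_pos.2 hy
  have pz := one_div_pos.2 hz
  generalize 1 / s = a at *
  generalize 1 / x = b at *
  generalize 1 / y = c at *
  generalize 1 / z = d at *
  rcases le_total b a with h1 | h1 <;> rcases le_total d c with h2 | h2
  · rcases le_total c a with h3 | h3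
    · exact Or.inl (add_lt_of_forall_le px py pz h1 h3 (h2.trans h3) q1)
    · exact Or.inr (Or.inr (Or.inl (add_lt_of_forall_le px ps pz (h1.trans h3) h3 h2 q3)))
  · rcases le_total d a with h3 | h3
    · exact Or.inl (add_lt_of_forall_le px py pz h1 (h2.trans h3) h3 q1)
    · exact Or.inr (Or.inr (Or.inr (add_lt_of_forall_le px py ps (h1.trans h3) h2 h3 q4)))
  · rcases le_total c b with h3 | h3
    · exact Or.inr (Or.inl (add_lt_of_forall_le ps py pz h1 h3 (h2.trans h3) q2))
    · exact Or.inr (Or.inr (Or.inl (add_lt_of_forall_le px ps pz h3 (h1.trans h3) h2 q3)))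
  · rcases le_total d b with h3 | h3
    · exact Or.inr (Or.inl (add_lt_of_forall_le ps py pz h1 (h2.trans h3) h3 q2))
    · exact Or.inr (Or.inr (Or.inr (add_lt_of_forall_le px py ps h3 h2 (h1.trans h3) q4)))

theorem edgeForm_neg_left (hx : 0 < x) (hy : 0 < y) (hz : 0 < z)
    (h : 1 / x + 1 / y + 1 / z < 1 / s) : edgeForm s x y z < 0 := by
  have px := one_div_pos.2 hx
  have py := one_div_pos.2 hy
  have pz := one_div_pos.2 hz
  rw [edgeForm, ← one_div_pow, ← one_div_pow]
  nlinarith [mul_pos px py, mul_pos px pz]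

theorem edgeForm_neg_right (hs : 0 < s) (hy : 0 < y) (hz : 0 < z)
    (h : 1 / s + 1 / y + 1 / z < 1 / x) : edgeForm s x y z < 0 := by
  have : edgeForm s x y z = edgeForm x s y z := by unfold edgeForm; ring
  rw [this]
  exact edgeForm_neg_left hs hy hz h

theorem edgeForm_pos_left (hs : 0 < s) (hx : 0 < x) (hz : 0 < z)
    (h : 1 / s + 1 / x + 1 / z < 1 / y) : 0 < edgeForm s x y z := by
  have ps := one_div_pos.2 hs
  have px := one_div_pos.2 hx
  have pz := one_div_pos.2 hz
  rw [edgeForm, ← one_div_pow, ← one_div_pow]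
  nlinarith [mul_pos ps px, mul_pos ps pz, mul_pos px pz]

theorem edgeForm_pos_right (hs : 0 < s) (hx : 0 < x) (hy : 0 < y)
    (h : 1 / s + 1 / x + 1 / y < 1 / z) : 0 < edgeForm s x y z := by
  have : edgeForm s x y z = edgeForm s x z y := by unfold edgeForm; ring
  rw [this]
  exact edgeForm_pos_left hs hx hy h

/-- All three normals are positive multiples of the third basis vector, so the cone is a half space.
-/
theorem coneAngle_coframe_of_gap (hs : 0 < s) (hx : 0 < x) (hy : 0 < y) (hz : 0 < z)
    (hQ : radiiQ s x y z ≤ 0) (h : 1 / x + 1 / y + 1 / z < 1 / s) :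
    coneAngle (coframe s x y z) = 2 * Real.pi := by
  have hC := frameC_pos hs hx hy
  have h1 : frameE s x y z < 0 := by
    rw [frameE_eq hs hx hy hz]
    exact mul_neg_of_pos_of_neg (by positivity) (edgeForm_neg_left hx hy hz h)
  have h2 : 0 < frameE s x y z * frameB s x y - frameB s x z * frameC s x y := by
    rw [frameE_mul_frameB_sub hs hx hy hz, neg_pos]
    exact mul_neg_of_pos_of_neg (by positivity) (edgeForm_neg_left hy hx hz (by linarith))
  refine coneAngle_eq_two_pi (v := !₂[0, 0, 1]) (fun h => ?_) fun u => ?_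
  · simpa using congr($h 2)
  rw [forall_inner_coframe_nonneg_iff, frameF_eq_zero hs hx hy hQ, inner_mk_three_left]
  simp only [zero_mul, sub_zero, zero_add, one_mul, zero_sub]
  refine ⟨fun h => h.2.2, fun h => ⟨mul_nonneg h2.le h, ?_, h⟩⟩
  have := mul_nonneg (neg_nonneg.2 h1.le) h
  linarith

/-- Another ball passes through its gap, and then one of the first two normals points opposite to
the third basis vector. The cone collapses into the plane `u 2 = 0`. -/
theorem coneAngle_coframe_of_not_gap (hs : 0 < s) (hx : 0 < x) (hy : 0 < y) (hz : 0 < z)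
    (hQ : radiiQ s x y z ≤ 0) (h : ¬ 1 / x + 1 / y + 1 / z < 1 / s) :
    coneAngle (coframe s x y z) = 0 := by
  have hC := frameC_pos hs hx hy
  have key : 0 < frameE s x y z ∨
      frameE s x y z * frameB s x y - frameB s x z * frameC s x y < 0 := by
    rw [frameE_mul_frameB_sub hs hx hy hz, neg_lt_zero, frameE_eq hs hx hy hz]
    rcases exists_add_lt_of_radiiQ_nonpos hs hx hy hz hQ with h | h | h | h
    · contradiction
    · exact Or.inr (mul_pos (by positivity) (edgeForm_pos_left hs hy hz (by linarith)))
    · exact Or.inl (mul_pos (by positivity) (edgeForm_pos_left hs hx hz (by linarith)))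
    · exact Or.inl (mul_pos (by positivity) (edgeForm_pos_right hs hx hy (by linarith)))
  refine coneAngle_eq_zero (v := !₂[0, 0, 1]) (fun h => ?_) fun u => ?_
  · simpa using congr($h 2)
  rw [forall_inner_coframe_nonneg_iff, frameF_eq_zero hs hx hy hQ, inner_mk_three_left]
  simp only [zero_mul, sub_zero, zero_add, one_mul, zero_sub]
  rintro ⟨h1, h2, h3⟩
  rcases key with h4 | h4 <;> nlinarith

/-- For `Q > 0` the height `frameF` is positive. For `Q ≤ 0`, including the boundary `Q = 0`, one
curvature strictly exceeds the sum of the others, which makes both values of `edgeForm` nonzero. -/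
theorem coframe_ne_zero (hs : 0 < s) (hx : 0 < x) (hy : 0 < y) (hz : 0 < z) (m : Fin 3) :
    coframe s x y z m ≠ 0 := by
  have hC := frameC_pos hs hx hy
  have ne : ∀ {a b c : ℝ}, (a ≠ 0 ∨ b ≠ 0 ∨ c ≠ 0) → (!₂[a, b, c] : E3) ≠ 0 := by
    rintro a b c h h'
    have e0 : a = 0 := by simpa using congr($h' 0)
    have e1 : b = 0 := by simpa using congr($h' 1)
    have e2 : c = 0 := by simpa using congr($h' 2)
    tauto
  have key : 0 < radiiQ s x y z ∨ (edgeForm s x y z ≠ 0 ∧ edgeForm s y x z ≠ 0) := by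
    rcases lt_or_ge 0 (radiiQ s x y z) with hQ | hQ
    · exact Or.inl hQ
    right
    rcases exists_add_lt_of_radiiQ_nonpos hs hx hy hz hQ with h | h | h | h
    · exact ⟨(edgeForm_neg_left hx hy hz h).ne,
        (edgeForm_neg_left hy hx hz (by linarith)).ne⟩
    · exact ⟨(edgeForm_neg_right hs hy hz h).ne,
        (edgeForm_pos_left hs hy hz (by linarith)).ne'⟩
    · exact ⟨(edgeForm_pos_left hs hx hz (by linarith)).ne',
        (edgeForm_neg_right hs hx hz (by linarith)).ne⟩
    · exact ⟨(edgeForm_pos_right hs hx hy (by linarith)).ne',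
        (edgeForm_pos_right hs hy hx (by linarith)).ne'⟩
  fin_cases m
  · refine ne ?_
    rcases key with hQ | ⟨-, h⟩
    · exact Or.inl (mul_pos (frameF_pos hs hx hy hz hQ) hC).ne'
    · refine Or.inr (Or.inr ?_)
      rw [frameE_mul_frameB_sub hs hx hy hz]
      exact neg_ne_zero.2 (mul_ne_zero (by positivity) h)
  · refine ne ?_
    rcases key with hQ | ⟨h, -⟩
    · exact Or.inr (Or.inl (frameF_pos hs hx hy hz hQ).ne')
    · refine Or.inr (Or.inr ?_)
      rw [frameE_eq hs hx hy hz]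
      exact neg_ne_zero.2 (mul_ne_zero (by positivity) h)
  · exact ne (Or.inr (Or.inr one_ne_zero))

theorem continuousAt_coframe {X : Type*} [TopologicalSpace X] {f g h k : X → ℝ} {p : X}
    (hf : ContinuousAt f p) (hg : ContinuousAt g p) (hh : ContinuousAt h p)
    (hk : ContinuousAt k p) (pf : 0 < f p) (pg : 0 < g p) (ph : 0 < h p) (pk : 0 < k p) :
    ContinuousAt (fun t => coframe (f t) (g t) (h t) (k t)) p := by
  have hG : ∀ {f g h : X → ℝ}, ContinuousAt f p → ContinuousAt g p → ContinuousAt h p →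
      ContinuousAt (fun t => gramEntry (f t) (g t) (h t)) p := by
    intro f g h hf hg hh
    unfold gramEntry
    fun_prop
  have hfg : f p + g p ≠ 0 := by positivity
  have hfgh : f p + g p + h p ≠ 0 := by positivity
  have hB1 : ContinuousAt (fun t => frameB (f t) (g t) (h t)) p :=
    (hG hf hg hh).div (hf.add hg) hfg
  have hB2 : ContinuousAt (fun t => frameB (f t) (g t) (k t)) p :=
    (hG hf hg hk).div (hf.add hg) hfg
  have hC : ContinuousAt (fun t => frameC (f t) (g t) (h t)) p := by
    unfold frameC
    fun_prop (disch := exact hfg)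
  have hE : ContinuousAt (fun t => frameE (f t) (g t) (h t) (k t)) p :=
    ((hG hf hh hk).sub (hB1.mul hB2)).div hC (frameC_pos pf pg ph).ne'
  have hQ : ContinuousAt (fun t => radiiQ (f t) (g t) (h t) (k t)) p := by
    have := pf.ne'
    have := pg.ne'
    have := ph.ne'
    have := pk.ne'
    unfold radiiQ
    fun_prop (disch := simpa)
  have hF : ContinuousAt (fun t => frameF (f t) (g t) (h t) (k t)) p := by
    unfold frameF
    fun_prop (disch := exact hfgh)
  have hmk : ∀ {a b c : X → ℝ}, ContinuousAt a p → ContinuousAt b p → ContinuousAt c p →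
      ContinuousAt (fun t => (!₂[a t, b t, c t] : E3)) p := by
    intro a b c ha hb hc
    refine (PiLp.continuous_toLp 2 _).continuousAt.comp (continuousAt_pi.2 fun i => ?_)
    fin_cases i <;> assumption
  refine continuousAt_pi.2 fun m => ?_
  fin_cases m
  · exact hmk (hF.mul hC) (hF.mul hB1).neg ((hE.mul hB1).sub (hB2.mul hC))
  · exact hmk continuousAt_const hF hE.neg
  · exact continuousAt_const

end Frame

/-! ### From labelled radii to tetrahedra: existence, solid angles, gaps. -/

section Tetrahedron

variable {N : ℕ} {τ : Finset (Fin N)} {i j k l : Fin N} {r : Fin N → ℝ} {p : Fin N → E3}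

/-- `i, j, k, l` are the elements of `τ` in some order. -/
structure IsLabelling (τ : Finset (Fin N)) (i j k l : Fin N) : Prop where
  mem : i ∈ τ
  erase_eq : τ.erase i = {j, k, l}
  ne₁₂ : j ≠ k
  ne₁₃ : j ≠ l
  ne₂₃ : k ≠ l

theorem exists_isLabelling (hτ : τ.card = 4) (hi : i ∈ τ) : ∃ j k l, IsLabelling τ i j k l := by
  have h : (τ.erase i).card = 3 := by rw [Finset.card_erase_of_mem hi, hτ]
  obtain ⟨j, k, l, h1, h2, h3, h4⟩ := Finset.card_eq_three.1 h
  exact ⟨j, k, l, hi, h4, h1, h2, h3⟩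

theorem IsLabelling.eq_insert (h : IsLabelling τ i j k l) : τ = {i, j, k, l} := by
  rw [← Finset.insert_erase h.mem, h.erase_eq]

theorem IsLabelling.mem_erase_iff (h : IsLabelling τ i j k l) {n : Fin N} :
    n ∈ τ.erase i ↔ n = j ∨ n = k ∨ n = l := by
  rw [h.erase_eq]; simp

theorem IsLabelling.ne_left (h : IsLabelling τ i j k l) : i ≠ j ∧ i ≠ k ∧ i ≠ l := by
  have := h.mem_erase_iff (n := i)
  simp only [Finset.notMem_erase, false_iff] at this
  tauto

theorem IsLabelling.sum_erase (h : IsLabelling τ i j k l) {A : Type*} [AddCommMonoid A]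
    (f : Fin N → A) : ∑ n ∈ τ.erase i, f n = f j + f k + f l := by
  rw [h.erase_eq, Finset.sum_insert (by simp [h.ne₁₂, h.ne₁₃]), Finset.sum_pair h.ne₂₃, add_assoc]

theorem IsLabelling.swap₁₂ (h : IsLabelling τ i j k l) : IsLabelling τ j i k l := by
  obtain ⟨h1, h2, h3⟩ := h.ne_left
  refine ⟨by simp [h.eq_insert], ?_, h2, h3, h.ne₂₃⟩
  have h4 := h.ne₁₂.symm
  have h5 := h.ne₁₃.symm
  rw [h.eq_insert]
  ext n
  simp only [Finset.mem_erase, Finset.mem_insert, Finset.mem_singleton]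
  constructor
  · tauto
  · rintro (rfl | rfl | rfl) <;> simp [h1, h2.symm, h3.symm, h4, h5]

theorem IsLabelling.rotate (h : IsLabelling τ i j k l) : IsLabelling τ i k l j := by
  refine ⟨h.mem, ?_, h.ne₂₃, h.ne₁₂.symm, h.ne₁₃.symm⟩
  rw [h.erase_eq]
  ext n
  simp only [Finset.mem_insert, Finset.mem_singleton]
  tauto

theorem IsLabelling.Q_eq (h : IsLabelling τ i j k l) (r : Fin N → ℝ) :
    Q τ r = radiiQ (r i) (r j) (r k) (r l) := by
  rw [Q, ← Finset.add_sum_erase _ _ h.mem, ← Finset.add_sum_erase _ _ h.mem, h.sum_erase,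
    h.sum_erase, radiiQ]
  ring

theorem IsLabelling.throughGap_iff (h : IsLabelling τ i j k l) (r : Fin N → ℝ) :
    ThroughGap τ i r ↔ IsGap (r i) (r j) (r k) (r l) := by
  have e : ∑ s ∈ (τ.erase i).powersetCard 2, 1 / ∏ n ∈ s, r n =
      1 / (r j * r k) + 1 / (r j * r l) + 1 / (r k * r l) := by
    have : (τ.erase i).powersetCard 2 = {{j, k}, {j, l}, {k, l}} := by
      rw [h.erase_eq]
      have h1 := h.ne₁₂
      have h2 := h.ne₁₃
      have h3 := h.ne₂₃
      rw [Finset.powersetCard_succ_insert (by simp [h1, h2]),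
        Finset.powersetCard_succ_insert (by simp [h3])]
      ext s
      have : ¬((s = ∅ ∨ s = {l}) ∧ s.card = 2) := by
        rintro ⟨rfl | rfl, h⟩ <;> simp at h
      simp [Finset.powersetCard_one]
      tauto
    have n1 := h.ne₁₂
    have n2 := h.ne₁₃
    have n3 := h.ne₂₃
    have d1 : ({j, k} : Finset (Fin N)) ≠ {j, l} := fun e => by
      have : k ∈ ({j, l} : Finset (Fin N)) := e ▸ by simp
      simp [n1.symm, n3] at this
    have d2 : ({j, k} : Finset (Fin N)) ≠ {k, l} := fun e => by
      have : j ∈ ({k, l} : Finset (Fin N)) := e ▸ by simp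
      simp [n1, n2] at this
    have d3 : ({j, l} : Finset (Fin N)) ≠ {k, l} := fun e => by
      have : j ∈ ({k, l} : Finset (Fin N)) := e ▸ by simp
      simp [n1, n2] at this
    rw [this, Finset.sum_insert (by simp [d1, d2]), Finset.sum_pair d3, Finset.prod_pair n1,
      Finset.prod_pair n2, Finset.prod_pair n3, add_assoc]
  rw [ThroughGap, e, h.sum_erase, IsGap]

/-- The edge vectors at `p i`. -/
def edgeVec (p : Fin N → E3) (i j k l : Fin N) : Fin 3 → E3 := ![p j - p i, p k - p i, p l - p i]

theorem IsLabelling.affineIndependent_iff (h : IsLabelling τ i j k l) (p : Fin N → E3) :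
    AffineIndependent ℝ (fun n : τ => p n) ↔ LinearIndependent ℝ (edgeVec p i j k l) := by
  have mj : j ∈ τ := Finset.mem_of_mem_erase (h.mem_erase_iff.2 (Or.inl rfl))
  have mk : k ∈ τ := Finset.mem_of_mem_erase (h.mem_erase_iff.2 (Or.inr (Or.inl rfl)))
  have ml : l ∈ τ := Finset.mem_of_mem_erase (h.mem_erase_iff.2 (Or.inr (Or.inr rfl)))
  obtain ⟨nj, nk, nl⟩ := h.ne_left
  rw [affineIndependent_iff_linearIndependent_vsub ℝ _ (⟨i, h.mem⟩ : τ)]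
  let f : Fin 3 → {n : τ // n ≠ ⟨i, h.mem⟩} :=
    ![⟨⟨j, mj⟩, by simpa using nj.symm⟩, ⟨⟨k, mk⟩, by simpa using nk.symm⟩,
      ⟨⟨l, ml⟩, by simpa using nl.symm⟩]
  have hf : Function.Bijective f := by
    have h1 := h.ne₁₂
    have h2 := h.ne₁₃
    have h3 := h.ne₂₃
    constructor
    · intro a b hab
      fin_cases a <;> fin_cases b <;> simp_all [f]
    · rintro ⟨⟨n, hn⟩, hne⟩
      have hni : n ≠ i := fun e => hne (Subtype.ext e)
      rcases h.mem_erase_iff.1 (Finset.mem_erase.2 ⟨hni, hn⟩) with rfl | rfl | rfl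
      · exact ⟨0, rfl⟩
      · exact ⟨1, rfl⟩
      · exact ⟨2, rfl⟩
  rw [← linearIndependent_equiv (Equiv.ofBijective f hf)]
  have : ((fun n : {n : τ // n ≠ ⟨i, h.mem⟩} => p n -ᵥ p i) ∘ Equiv.ofBijective f hf) =
      edgeVec p i j k l := by
    funext a; fin_cases a <;> rfl
  rw [← this]

theorem det_gramMatrix {s x y z : ℝ} (hs : 0 < s) (hx : 0 < x) (hy : 0 < y) (hz : 0 < z) :
    (gramMatrix s x y z).det = 4 * s ^ 2 * x ^ 2 * y ^ 2 * z ^ 2 * radiiQ s x y z := by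
  rw [gramMatrix, Matrix.det_fin_three, radiiQ]
  simp [gramEntry]
  field_simp
  ring

/-- The law of cosines; it translates the edge lengths opposite to a vertex into Gram matrix entries
at that vertex. -/
theorem inner_sub_sub_eq_gramEntry_iff {a b c : E3} {s x y : ℝ} (hx : 0 < x) (hy : 0 < y)
    (hab : dist a b = s + x) (hac : dist a c = s + y) :
    inner ℝ (b - a) (c - a) = gramEntry s x y ↔ dist b c = x + y := by
  have h1 : ‖b - c‖ ^ 2 = ‖b - a‖ ^ 2 - 2 * inner ℝ (b - a) (c - a) + ‖c - a‖ ^ 2 := by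
    rw [← norm_sub_sq_real, sub_sub_sub_cancel_right]
  rw [← dist_eq_norm, ← dist_eq_norm, ← dist_eq_norm, dist_comm b a, dist_comm c a, hab, hac] at h1
  rw [← sq_eq_sq₀ dist_nonneg (by positivity : 0 ≤ x + y), h1, gramEntry]
  constructor <;> intro h <;> linarith

theorem IsLabelling.isEuclideanTetrahedron_iff (h : IsLabelling τ i j k l)
    (hr : r ∈ positiveOrthant N) :
    IsEuclideanTetrahedron τ r p ↔ LinearIndependent ℝ (edgeVec p i j k l) ∧
      ∀ m n, inner ℝ (edgeVec p i j k l m) (edgeVec p i j k l n) =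
        gramMatrix (r i) (r j) (r k) (r l) m n := by
  rw [IsEuclideanTetrahedron, h.affineIndependent_iff]
  refine and_congr_right fun _ => ?_
  obtain ⟨nj, nk, nl⟩ := h.ne_left
  have hri := hr i
  have hnorm : ∀ n, dist (p i) (p n) = r i + r n ↔
      inner ℝ (p n - p i) (p n - p i) = (r i + r n) ^ 2 := fun n => by
    rw [real_inner_self_eq_norm_sq, ← dist_eq_norm, dist_comm (p n),
      sq_eq_sq₀ dist_nonneg (add_pos (hr i) (hr n)).le]
  have hsym : (∀ a ∈ τ, ∀ b ∈ τ, a ≠ b → dist (p a) (p b) = r a + r b) ↔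
      (dist (p i) (p j) = r i + r j ∧ dist (p i) (p k) = r i + r k ∧
      dist (p i) (p l) = r i + r l) ∧ dist (p j) (p k) = r j + r k ∧
      dist (p j) (p l) = r j + r l ∧ dist (p k) (p l) = r k + r l := by
    have hc : ∀ a b, dist (p a) (p b) = r a + r b → dist (p b) (p a) = r b + r a := fun a b h => by
      rw [dist_comm, h, add_comm]
    constructor
    · intro H
      have mem : ∀ n, n = i ∨ n = j ∨ n = k ∨ n = l → n ∈ τ := fun n hn => by
        rw [h.eq_insert]; simpa using hn
      exact ⟨⟨H _ (mem _ (by simp)) _ (mem _ (by simp)) nj,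
        H _ (mem _ (by simp)) _ (mem _ (by simp)) nk,
        H _ (mem _ (by simp)) _ (mem _ (by simp)) nl⟩,
        H _ (mem _ (by simp)) _ (mem _ (by simp)) h.ne₁₂,
        H _ (mem _ (by simp)) _ (mem _ (by simp)) h.ne₁₃,
        H _ (mem _ (by simp)) _ (mem _ (by simp)) h.ne₂₃⟩
    · rintro ⟨⟨h1, h2, h3⟩, h4, h5, h6⟩ a ha b hb hab
      rw [h.eq_insert] at ha hb
      simp only [Finset.mem_insert, Finset.mem_singleton] at ha hb
      rcases ha with rfl | rfl | rfl | rfl <;> rcases hb with rfl | rfl | rfl | rfl <;>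
        first | exact absurd rfl hab | assumption | (apply hc; assumption)
  rw [hsym]
  constructor
  · rintro ⟨⟨h1, h2, h3⟩, h4, h5, h6⟩
    have e1 := (hnorm j).1 h1
    have e2 := (hnorm k).1 h2
    have e3 := (hnorm l).1 h3
    have e4 := (inner_sub_sub_eq_gramEntry_iff (hr j) (hr k) h1 h2).2 h4
    have e5 := (inner_sub_sub_eq_gramEntry_iff (hr j) (hr l) h1 h3).2 h5
    have e6 := (inner_sub_sub_eq_gramEntry_iff (hr k) (hr l) h2 h3).2 h6
    intro m n
    fin_cases m <;> fin_cases n <;>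
      first | assumption | (refine (real_inner_comm _ _).trans ?_; assumption)
  · intro H
    have h1 := (hnorm j).2 (H 0 0)
    have h2 := (hnorm k).2 (H 1 1)
    have h3 := (hnorm l).2 (H 2 2)
    exact ⟨⟨h1, h2, h3⟩, (inner_sub_sub_eq_gramEntry_iff (hr j) (hr k) h1 h2).1 (H 0 1),
      (inner_sub_sub_eq_gramEntry_iff (hr j) (hr l) h1 h3).1 (H 0 2),
      (inner_sub_sub_eq_gramEntry_iff (hr k) (hr l) h2 h3).1 (H 1 2)⟩

/-- The Gram matrix of independent edge vectors is positive definite, and its determinant is a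
positive multiple of `Q`. -/
theorem IsLabelling.radiiQ_pos (h : IsLabelling τ i j k l) (hr : r ∈ positiveOrthant N)
    (hp : IsEuclideanTetrahedron τ r p) : 0 < radiiQ (r i) (r j) (r k) (r l) := by
  obtain ⟨h1, h2⟩ := (h.isEuclideanTetrahedron_iff hr).1 hp
  have h3 : Matrix.gram ℝ (edgeVec p i j k l) = gramMatrix (r i) (r j) (r k) (r l) := by
    ext m n; exact h2 m n
  have h4 := (Matrix.posDef_gram_of_linearIndependent (𝕜 := ℝ) h1).det_pos
  have hi := hr i
  have hj := hr j
  have hk := hr k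
  have hl := hr l
  rw [h3, det_gramMatrix hi hj hk hl] at h4
  exact pos_of_mul_pos_right h4 (by positivity)

theorem IsLabelling.exists_isEuclideanTetrahedron (h : IsLabelling τ i j k l)
    (hr : r ∈ positiveOrthant N) (hQ : 0 < radiiQ (r i) (r j) (r k) (r l)) :
    ∃ p, IsEuclideanTetrahedron τ r p := by
  let v := frame (r i) (r j) (r k) (r l)
  -- The vertex `i` sits at the origin, so the edge vectors at `i` are those of `frame`.
  let p : Fin N → E3 := fun n => if n = j then v 0 else if n = k then v 1 else
    if n = l then v 2 else 0
  have hp : edgeVec p i j k l = v := by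
    obtain ⟨nj, nk, nl⟩ := h.ne_left
    funext a
    fin_cases a <;> simp [edgeVec, p, nj, nk, nl, h.ne₁₂.symm, h.ne₁₃.symm, h.ne₂₃.symm]
  refine ⟨p, (h.isEuclideanTetrahedron_iff hr).2 ?_⟩
  rw [hp]
  exact ⟨linearIndependent_frame (hr i) (hr j) (hr k) (hr l) hQ,
    inner_frame (hr i) (hr j) (hr k) (hr l) hQ.le⟩

theorem IsLabelling.solidAngle_eq (h : IsLabelling τ i j k l) (hr : r ∈ positiveOrthant N)
    (hp : IsEuclideanTetrahedron τ r p) :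
    solidAngle p τ i = coneAngle (coframe (r i) (r j) (r k) (r l)) := by
  have hQ := h.radiiQ_pos hr hp
  obtain ⟨h1, h2⟩ := (h.isEuclideanTetrahedron_iff hr).1 hp
  obtain ⟨Φ, hΦ⟩ := exists_linearIsometryEquiv h1
    (linearIndependent_frame (hr i) (hr j) (hr k) (hr l) hQ) fun m n =>
      (h2 m n).trans (inner_frame (hr i) (hr j) (hr k) (hr l) hQ.le m n).symm
  refine solidAngle_eq_coneAngle Φ fun u => ?_
  rw [← exists_eq_frame_iff (hr i) (hr j) (hr k) (hr l) hQ, ← hΦ, ← hΦ, ← hΦ]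
  simp only [← map_smul, ← map_add, Φ.injective.eq_iff, h.sum_erase]
  constructor
  · rintro ⟨c, hc, hu⟩
    exact ⟨c j, c k, c l, hc j, hc k, hc l, hu⟩
  · rintro ⟨a, b, c, ha, hb, hc, hu⟩
    refine ⟨fun n => if n = j then a else if n = k then b else c, fun n => ?_, ?_⟩
    · dsimp only; split_ifs <;> assumption
    · simpa [h.ne₁₂.symm, h.ne₁₃.symm, h.ne₂₃.symm, edgeVec] using hu

theorem IsLabelling.realAngle_eq (h : IsLabelling τ i j k l) (hr : r ∈ positiveOrthant N)
    (hQ : 0 < radiiQ (r i) (r j) (r k) (r l)) :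
    realAngle τ i r = coneAngle (coframe (r i) (r j) (r k) (r l)) := by
  have hex := h.exists_isEuclideanTetrahedron hr hQ
  rw [realAngle, dif_pos hex]
  exact h.solidAngle_eq hr hex.choose_spec

theorem IsLabelling.throughGap_iff_lt (h : IsLabelling τ i j k l) (hr : r ∈ positiveOrthant N)
    (hQ : radiiQ (r i) (r j) (r k) (r l) ≤ 0) :
    ThroughGap τ i r ↔ 1 / r j + 1 / r k + 1 / r l < 1 / r i := by
  rw [h.throughGap_iff]
  exact ⟨fun h => h.lt (hr i) (hr j) (hr k) (hr l),
    isGap_of_lt (hr i) (hr j) (hr k) (hr l) hQ⟩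

/-- The extended solid angle is given on all real and virtual packings by one formula. -/
theorem IsLabelling.extAngle_eq (h : IsLabelling τ i j k l) (hr : r ∈ positiveOrthant N) :
    extAngle τ i r = coneAngle (coframe (r i) (r j) (r k) (r l)) := by
  rw [extAngle, h.Q_eq]
  split_ifs with hQ hg
  · exact h.realAngle_eq hr hQ
  · rw [h.throughGap_iff_lt hr (not_lt.1 hQ)] at hg
    exact (coneAngle_coframe_of_gap (hr i) (hr j) (hr k) (hr l) (not_lt.1 hQ) hg).symm
  · rw [h.throughGap_iff_lt hr (not_lt.1 hQ)] at hg
    exact (coneAngle_coframe_of_not_gap (hr i) (hr j) (hr k) (hr l) (not_lt.1 hQ) hg).symm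

theorem IsLabelling.exists_throughGap (h : IsLabelling τ i j k l) (hr : r ∈ positiveOrthant N)
    (hQ : Q τ r ≤ 0) : ∃ n ∈ τ, ThroughGap τ n r := by
  have hQ' := hQ
  rw [h.Q_eq] at hQ'
  have key : ∀ {a b c d : Fin N}, IsLabelling τ a b c d →
      1 / r b + 1 / r c + 1 / r d < 1 / r a → ∃ n ∈ τ, ThroughGap τ n r := by
    intro a b c d h' hlt
    rw [h'.Q_eq] at hQ
    exact ⟨a, h'.mem, (h'.throughGap_iff_lt hr hQ).2 hlt⟩
  rcases exists_add_lt_of_radiiQ_nonpos (hr i) (hr j) (hr k) (hr l) hQ' with h' | h' | h' | h'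
  · exact key h h'
  · exact key h.swap₁₂ h'
  · exact key h.rotate.swap₁₂ (by linarith)
  · exact key h.rotate.rotate.swap₁₂ (by linarith)

/-- A ball that passes through the gap has strictly larger curvature than each of the other three,
which cannot hold for two balls at once. -/
theorem not_throughGap_of_ne (hτ : τ.card = 4) (hr : r ∈ positiveOrthant N) (hi : i ∈ τ)
    (hj : j ∈ τ) (hij : j ≠ i) (hg : ThroughGap τ i r) : ¬ ThroughGap τ j r := by
  intro hg'
  have key : ∀ {a b : Fin N}, a ∈ τ → b ∈ τ → b ≠ a → ThroughGap τ a r → 1 / r b < 1 / r a := by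
    intro a b ha hb hba hg
    obtain ⟨b', c, d, h⟩ := exists_isLabelling hτ ha
    have hlt := ((h.throughGap_iff r).1 hg).lt (hr a) (hr b') (hr c) (hr d)
    have p1 := one_div_pos.2 (hr b')
    have p2 := one_div_pos.2 (hr c)
    have p3 := one_div_pos.2 (hr d)
    rcases h.mem_erase_iff.1 (Finset.mem_erase.2 ⟨hba, hb⟩) with rfl | rfl | rfl <;> linarith
  exact (key hi hj hij hg).asymm (key hj hi hij.symm hg')

theorem continuousOn_extAngle (hτ : τ.card = 4) (hi : i ∈ τ) :
    ContinuousOn (extAngle τ i) (positiveOrthant N) := by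
  obtain ⟨j, k, l, h⟩ := exists_isLabelling hτ hi
  have hc : ContinuousOn (fun r : Fin N → ℝ => coneAngle (coframe (r i) (r j) (r k) (r l)))
      (positiveOrthant N) := fun r hr =>
    (ContinuousAt.comp (f := fun r : Fin N → ℝ => coframe (r i) (r j) (r k) (r l))
      (continuousAt_coneAngle (coframe_ne_zero (hr i) (hr j) (hr k) (hr l)))
      (continuousAt_coframe (continuous_apply i).continuousAt (continuous_apply j).continuousAt
        (continuous_apply k).continuousAt (continuous_apply l).continuousAt (hr i) (hr j) (hr k)
        (hr l))).continuousWithinAt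
  exact hc.congr fun r hr => h.extAngle_eq hr

theorem abs_extAngle_le (hτ : τ.card = 4) (hi : i ∈ τ) (hr : r ∈ positiveOrthant N) :
    |extAngle τ i r| ≤ 4 * Real.pi := by
  obtain ⟨j, k, l, h⟩ := exists_isLabelling hτ hi
  rw [h.extAngle_eq hr, abs_of_nonneg (coneAngle_nonneg _)]
  exact coneAngle_le _

end Tetrahedron

/-! ### Continuity and boundedness of the extended curvature. -/

section Curvature

variable {M : Type*} [TopologicalSpace M] {N : ℕ} (T : Triangulation M N)

theorem Triangulation.card_of_mem_tetrahedra {T : Triangulation M N} {τ : Finset (Fin N)}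
    (hτ : τ ∈ T.tetrahedra) : τ.card = 4 := by
  simp only [Triangulation.tetrahedra, Finset.mem_filter] at hτ
  exact hτ.2.2

theorem continuousOn_extCurvature (i : Fin N) :
    ContinuousOn (fun r => extCurvature T r i) (positiveOrthant N) := by
  refine continuousOn_const.sub (continuousOn_finsetSum _ fun τ hτ => ?_)
  rw [Finset.mem_filter] at hτ
  exact continuousOn_extAngle (Triangulation.card_of_mem_tetrahedra hτ.1) hτ.2

theorem abs_extCurvature_le (r : Fin N → ℝ) (hr : r ∈ positiveOrthant N) (i : Fin N) :
    |extCurvature T r i| ≤ 4 * Real.pi + T.tetrahedra.card * (4 * Real.pi) := by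
  refine (abs_sub _ _).trans (add_le_add (abs_of_pos (by positivity)).le ?_)
  calc |∑ τ ∈ T.tetrahedra with i ∈ τ, extAngle τ i r|
      ≤ ∑ τ ∈ T.tetrahedra with i ∈ τ, |extAngle τ i r| := Finset.abs_sum_le_sum_abs _ _
    _ ≤ ∑ τ ∈ T.tetrahedra with i ∈ τ, 4 * Real.pi := by
        refine Finset.sum_le_sum fun τ hτ => ?_
        rw [Finset.mem_filter] at hτ
        exact abs_extAngle_le (Triangulation.card_of_mem_tetrahedra hτ.1) hτ.2 hr
    _ ≤ T.tetrahedra.card * (4 * Real.pi) := by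
        rw [Finset.sum_const, nsmul_eq_mul]
        gcongr
        exact Finset.filter_subset _ _

theorem extCurvature_eq_curvature {r : Fin N → ℝ} (hr : r ∈ realPackings T) :
    extCurvature T r = curvature T r := by
  funext i
  refine congrArg _ (Finset.sum_congr rfl fun τ hτ => if_pos ?_)
  exact hr.2 τ (Finset.mem_filter.1 hτ).1

theorem IsYamabeFlow.isExtendedFlow {I : Set ℝ} {r : ℝ → Fin N → ℝ} {T : Triangulation M N}
    (h : IsYamabeFlow T I r) : IsExtendedFlow T I r := fun t ht => by
  obtain ⟨h1, h2⟩ := h t ht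
  rw [extCurvature_eq_curvature T h1]
  exact ⟨h1.1, h2⟩

end Curvature

end BallPacking

/-! ### The main theorem. -/

theorem theorem1p3 {M : Type*} [TopologicalSpace M] [T2Space M] [CompactSpace M]
    [ChartedSpace (EuclideanSpace ℝ (Fin 3)) M] {N : ℕ} (T : BallPacking.Triangulation M N) :
    -- the extended solid angles are well defined and extend the solid angles
    (∀ τ ∈ T.tetrahedra, ∀ r ∈ BallPacking.positiveOrthant N,
      (0 < BallPacking.Q τ r ↔ ∃ p, BallPacking.IsEuclideanTetrahedron τ r p) ∧
      (∀ p, BallPacking.IsEuclideanTetrahedron τ r p →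
        ∀ i ∈ τ, BallPacking.extAngle τ i r = BallPacking.solidAngle p τ i) ∧
      (BallPacking.Q τ r ≤ 0 →
        ∃ i ∈ τ, BallPacking.ThroughGap τ i r ∧ BallPacking.extAngle τ i r = 2 * Real.pi ∧
          ∀ j ∈ τ, j ≠ i → ¬ BallPacking.ThroughGap τ j r ∧ BallPacking.extAngle τ j r = 0)) ∧
    -- the extended solid angles are continuous
    (∀ τ ∈ T.tetrahedra, ∀ i ∈ τ,
      ContinuousOn (BallPacking.extAngle τ i) (BallPacking.positiveOrthant N)) ∧
    -- from every real or virtual packing there starts a solution for all time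
    (∀ r₀ ∈ BallPacking.positiveOrthant N, ∃ r : ℝ → Fin N → ℝ,
      r 0 = r₀ ∧ BallPacking.IsExtendedFlow T (Set.Ici 0) r) ∧
    -- every solution of the extended flow continues to a solution for all time
    (∀ (S : ℝ) (r : ℝ → Fin N → ℝ), 0 < S → BallPacking.IsExtendedFlow T (Set.Ico 0 S) r →
      ∃ R : ℝ → Fin N → ℝ, Set.EqOn R r (Set.Ico 0 S) ∧
        BallPacking.IsExtendedFlow T (Set.Ici 0) R) ∧
    -- so does every solution of the original flow on real packings
    (∀ (S : ℝ) (r : ℝ → Fin N → ℝ), 0 < S → BallPacking.IsYamabeFlow T (Set.Ico 0 S) r →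
      ∃ R : ℝ → Fin N → ℝ, Set.EqOn R r (Set.Ico 0 S) ∧
        BallPacking.IsExtendedFlow T (Set.Ici 0) R) := by
  have hc := BallPacking.continuousOn_extCurvature T
  have hb := BallPacking.abs_extCurvature_le T
  refine ⟨fun τ hτ r hr => ?_, fun τ hτ i hi =>
    BallPacking.continuousOn_extAngle (BallPacking.Triangulation.card_of_mem_tetrahedra hτ) hi,
    fun r₀ hr₀ => BallPacking.exists_isFlowOn_Ici hc hb hr₀,
    fun S r hS hr => BallPacking.IsFlowOn.exists_extend_Ici hc hb hS hr,
    fun S r hS hr => BallPacking.IsFlowOn.exists_extend_Ici hc hb hS hr.isExtendedFlow⟩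
  have hcard := BallPacking.Triangulation.card_of_mem_tetrahedra hτ
  obtain ⟨i, hi⟩ : τ.Nonempty := Finset.card_pos.1 (by omega)
  obtain ⟨j, k, l, h⟩ := BallPacking.exists_isLabelling hcard hi
  refine ⟨⟨fun hQ => ?_, fun ⟨p, hp⟩ => ?_⟩, fun p hp n hn => ?_, fun hQ => ?_⟩
  · exact h.exists_isEuclideanTetrahedron hr (h.Q_eq r ▸ hQ)
  · exact h.Q_eq r ▸ h.radiiQ_pos hr hp
  · obtain ⟨a, b, c, h'⟩ := BallPacking.exists_isLabelling hcard hn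
    rw [h'.extAngle_eq hr, h'.solidAngle_eq hr hp]
  · obtain ⟨n, hn, hg⟩ := h.exists_throughGap hr hQ
    refine ⟨n, hn, hg, ?_, fun m hm hmn => ?_⟩
    · rw [BallPacking.extAngle, if_neg hQ.not_gt, if_pos hg]
    · have hg' := BallPacking.not_throughGap_of_ne hcard hr hn hm hmn hg
      exact ⟨hg', by rw [BallPacking.extAngle, if_neg hQ.not_gt, if_neg hg']⟩
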